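/- **Setting.** Let $V=V_o\cup V_m$ be finitely many random variables, each with finitely many (at least two) values, where those in $V_o$ are fully observed and those in $V_m$ are partially observed. Each $X\in V_m$ has a missingness indicator $R_X\in\{0,1\}$ and a proxy $X^*$, with $X^*=X$ if $R_X=0$ and $X^*=m$ (missing) if $R_X=1$. An *m-graph* $G$ has as nodes $V$ and $R=\{R_X: X\in V_m\}$, and it has directed edges forming an acyclic graph, in which no variable in $V$ is a child of an $R$ variable, and bidirected edges, where $A\leftrightarrow B$ means that some exogenous latent variable is a parent of both $A$ and $B$. (The proxies are not drawn.) The distributions $P(V,R)$ *generated by* $G$ are those obtained by drawing the latent variables independently from arbitrary distributions and then each node from a conditional distribution given its observed and latent parents. A node is a *collider* on a path if the path enters and leaves it via arrowheads. For an indicator $R_X$, a *Markov blanket in* $V$ is a set $B\subseteq V$ such that $R_X$ is d-separated in $G$ by $B$ from every other node outside $B$. The joint distribution $P(V)$ is *recoverable* in $G$ if there is a sequence of estimators (functions of $n$ records of $(V^*,V_o,R)$, where $V^*$ denotes the proxies) that, on i.i.d. samples, is consistent for $P(V)$ for every $P$ generated by $G$ for which the observed-data distribution $P(V^*,V_o,R)$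 is strictly positive, except where the definition of $X^*$ forces a zero. **Theorem 2 (Recoverability of the joint $P(V)$).** Let $G$ be an m-graph with no edges (directed or bidirected) between $R$ variables. Consider the condition (C) there is no $X\in V_m$ such that 1. $X$ and $R_X$ are neighbours, or 2. $X$ and $R_X$ are connected by a path in which all intermediate nodes are colliders and elements of $V_m\cup V_o$. (a) If $P(V)$ is recoverable in $G$, then (C) holds. Conversely, if every $R$ variable has a Markov blanket in $V=V_o\cup V_m$ and (C) holds, then $P(V)$ is recoverable in $G$. (b) Suppose that $P(V)$ is recoverable. Then every $R_X$ that has a Markov blanket in $V$ has one that does not contain $X$. If $Mb_{X}\subseteq V\setminus\{X\}$ is a Markov blanket of $R_X$ for every $X\in V_m$, and $Mb^o_{X}=Mb_{X}\cap V_o$, $Mb^m_{X}=Mb_{X}\cap V_m$, then for every $P$ generated by $G$ with strictly positive observed-data distribution (in the above sense) and every value $v$ of $V$, $$P(v)=\frac{P(R=0,v)}{\prod_{X\in V_m}P\bigl(R_X=0\mid Mb^o_{X},\,Mb^m_{X},\,R_{Mb^m_{X}}=0\bigr)},$$ where the blankets take their values from $v$, and $R_{Mb^m_{X}}=0$ means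 $R_Y=0$ for all $Y\in Mb^m_{X}$. -/

import Mathlib

open MeasureTheory Filter Topology
open scoped ENNReal

noncomputable section

namespace Missing

/-- The nodes of an m-graph other than the latent variables: the substantive variables
`O ⊕ M`, where `O` indexes the fully observed and `M` the partially observed ones, and one
missingness indicator for every partially observed variable. (The proxy variables are
functions of these and are introduced with the observed data below.) -/
abbrev Node (O M : Type*) := (O ⊕ M) ⊕ M

variable {O M U : Type*}

/-- The node of a substantive variable. -/
abbrev var (a : O ⊕ M) : Node O M := Sum.inl a

/-- The missingness indicator `R_i` of the partially observed variable `i`. -/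
abbrev ind (i : M) : Node O M := Sum.inr i

/-- An m-graph: a directed acyclic graph on the nodes, together with exogenous latent
variables `U`, each of which is a parent of some of the nodes. No substantive variable is a
child of a missingness indicator. -/
structure MGraph (O M U : Type*) where
  /-- `dir a b`: there is a directed edge `a → b`. -/
  dir : Node O M → Node O M → Prop
  /-- `lat u b`: the latent variable `u` is a parent of `b`. -/
  lat : U → Node O M → Prop
  acyclic : ∀ a, ¬ Relation.TransGen dir a a
  ind_no_child : ∀ (i : M) (a : O ⊕ M), ¬ dir (ind i) (var a)

/-- The three ways in which an edge can be traversed: `a → b`, `a ← b`, `a ↔ b`. -/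
inductive EdgeKind
  | fwd
  | bwd
  | bi

/-- The edge has an arrowhead at the node at which its traversal starts. -/
def EdgeKind.headLeft : EdgeKind → Prop
  | .fwd => False
  | .bwd => True
  | .bi => True

/-- The edge has an arrowhead at the node at which its traversal ends. -/
def EdgeKind.headRight : EdgeKind → Prop
  | .fwd => True
  | .bwd => False
  | .bi => True

namespace MGraph

/-- The bidirected edge `a ↔ b`: some latent variable is a parent of both nodes. -/
def bidir (G : MGraph O M U) (a b : Node O M) : Prop :=
  a ≠ b ∧ ∃ u, G.lat u a ∧ G.lat u b

/-- `a` and `b` are joined by an edge that is traversed in the given way from `a` to `b`. -/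
def IsEdge (G : MGraph O M U) (k : EdgeKind) (a b : Node O M) : Prop :=
  match k with
  | .fwd => G.dir a b
  | .bwd => G.dir b a
  | .bi => G.bidir a b

/-- Two nodes are neighbours if they are joined by a directed or a bidirected edge. -/
def Neighbors (G : MGraph O M U) (a b : Node O M) : Prop :=
  ∃ k, G.IsEdge k a b

/-- A path from `a` to `b` (no node is repeated). Only the values `node i` with `i ≤ len` and
`kind i` with `i < len` matter; `kind i` is the kind of the edge from `node i` to
`node (i + 1)`. -/
structure Trail (G : MGraph O M U) (a b : Node O M) where
  len : ℕ
  node : ℕ → Node O M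
  kind : ℕ → EdgeKind
  start : node 0 = a
  finish : node len = b
  inj : ∀ i ≤ len, ∀ j ≤ len, node i = node j → i = j
  edge : ∀ i < len, G.IsEdge (kind i) (node i) (node (i + 1))

/-- The intermediate node at position `i` (where `0 < i < len`) is a collider on the path: the
path enters and leaves it through arrowheads. -/
def Trail.IsCollider {G : MGraph O M U} {a b : Node O M} (p : G.Trail a b) (i : ℕ) : Prop :=
  (p.kind (i - 1)).headRight ∧ (p.kind i).headLeft

/-- `d` is a descendant of `c` (every node is a descendant of itself). -/
def IsDescendant (G : MGraph O M U) (c d : Node O M) : Prop :=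
  Relation.ReflTransGen G.dir c d

/-- d-separation of two nodes by a set `Z`: every path between them has an intermediate node
that is a collider without descendants in `Z`, or a non-collider in `Z`. -/
def DSep (G : MGraph O M U) (a b : Node O M) (Z : Set (Node O M)) : Prop :=
  ∀ p : G.Trail a b, ∃ i, 0 < i ∧ i < p.len ∧
    ((p.IsCollider i ∧ ∀ d ∈ Z, ¬ G.IsDescendant (p.node i) d) ∨
      (¬ p.IsCollider i ∧ p.node i ∈ Z))

/-- `B` is a Markov blanket of the node `a`: given `B`, the node `a` is d-separated from all
the other nodes. -/
def IsMarkovBlanket (G : MGraph O M U) (a : Node O M) (B : Set (Node O M)) : Prop :=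
  a ∉ B ∧ ∀ b, b ≠ a → b ∉ B → G.DSep a b B

/-- The set `B` of substantive variables is a Markov blanket of `R_i`. -/
def IsIndBlanket (G : MGraph O M U) (i : M) (B : Set (O ⊕ M)) : Prop :=
  G.IsMarkovBlanket (ind i) (var '' B)

/-- There are no edges, directed or bidirected, between missingness indicators. -/
def NoIndEdges (G : MGraph O M U) : Prop :=
  ∀ i j : M, ¬ G.Neighbors (ind i) (ind j)

/-- The partially observed variable `i` and `R_i` are connected by a path all of whose
intermediate nodes are colliders and substantive variables. -/
def ColliderConnected (G : MGraph O M U) (i : M) : Prop :=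
  ∃ p : G.Trail (var (Sum.inr i)) (ind i), ∀ j, 0 < j → j < p.len →
    p.IsCollider j ∧ ∃ a, p.node j = var a

end MGraph

/-- The range of a node: `S a` for the substantive variable `a`, and `{0, 1}` for a missingness
indicator. -/
abbrev State (S : O ⊕ M → Type) : Node O M → Type :=
  Sum.elim S (fun _ => Fin 2)

/-- Joint values of all substantive variables and missingness indicators. -/
abbrev Config (S : O ⊕ M → Type) := ∀ a : Node O M, State S a

/-- The value of the substantive variable `a`. -/
def valOf {S : O ⊕ M → Type} (x : Config S) (a : O ⊕ M) : S a := x (var a)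

/-- The value of the missingness indicator `R_i`. -/
def indOf {S : O ⊕ M → Type} (x : Config S) (i : M) : Fin 2 := x (ind i)

/-- A probabilistic mechanism on an m-graph: independent latent variables with arbitrary
distributions, and for every node a conditional distribution given its parents, observed and
latent. -/
structure Mechanism (G : MGraph O M U) (S : O ⊕ M → Type) where
  /-- The ranges of the latent variables. -/
  T : U → Type
  [mT : ∀ u, MeasurableSpace (T u)]
  /-- The distributions of the latent variables. -/
  μ : ∀ u, Measure (T u)
  [prob : ∀ u, IsProbabilityMeasure (μ u)]
  /-- The conditional distribution of every node given its parents. -/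
  cpd : ∀ a : Node O M, (∀ b : {b // G.dir b a}, State S b) →
    (∀ u : {u // G.lat u a}, T u) → PMF (State S a)
  measurable_cpd : ∀ a y s, Measurable fun t => cpd a y t s

attribute [instance] Mechanism.mT Mechanism.prob

/-- The underlying distribution `P` of the substantive variables and the missingness indicators
is generated by the m-graph `G`: it is the marginal of a distribution that factorizes according
to the graph with its latent variables. -/
def MGraph.Generates [Fintype O] [Fintype M] [Fintype U] (G : MGraph O M U)
    (S : O ⊕ M → Type) (P : PMF (Config S)) : Prop :=
  ∃ K : Mechanism G S, ∀ x : Config S,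
    P x = ∫⁻ t : (∀ u, K.T u), ∏ a : Node O M,
      K.cpd a (fun b => x b) (fun u => t u) (x a) ∂(Measure.pi K.μ)

/-- A record of the observed data: the fully observed variables, the proxy variables (`none` is
the empty measurement) and the missingness indicators. -/
@[ext]
structure Record (S : O ⊕ M → Type) where
  obs : ∀ o : O, S (Sum.inl o)
  proxy : ∀ i : M, Option (S (Sum.inr i))
  ind : M → Fin 2

/-- Data records are discrete. -/
instance (S : O ⊕ M → Type) : MeasurableSpace (Record S) := ⊤

/-- The record that is observed: the proxy of `i` is the value of `i` if `R_i = 0`, and empty if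
`R_i = 1`. -/
def observe {S : O ⊕ M → Type} (x : Config S) : Record S where
  obs o := valOf x (Sum.inl o)
  proxy i := if indOf x i = 0 then some (valOf x (Sum.inr i)) else none
  ind i := indOf x i

/-- The observed-data distribution. -/
def obsLaw {S : O ⊕ M → Type} (P : PMF (Config S)) : PMF (Record S) :=
  P.map observe

/-- The observed-data distribution is strictly positive, except for the zero probabilities that
the definition of the proxy variables forces. -/
def ObsPositive {S : O ⊕ M → Type} (P : PMF (Config S)) : Prop :=
  ∀ x : Config S, 0 < obsLaw P (observe x)

/-- The target quantity `Q`, a functional of the underlying distribution, is recoverable in `G`: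
there is an estimator (for every sample size `n`, a function of `n` records) that, on independent
samples from the observed-data distribution, is consistent for `Q`, whatever the underlying
distribution generated by `G`, as long as the observed-data distribution is strictly positive. -/
def MGraph.Recoverable [Fintype O] [Fintype M] [Fintype U] (G : MGraph O M U)
    (S : O ⊕ M → Type) {E : Type*} [PseudoMetricSpace E] (Q : PMF (Config S) → E) : Prop :=
  ∃ est : ∀ n : ℕ, (Fin n → Record S) → E,
    ∀ P : PMF (Config S), G.Generates S P → ObsPositive P → ∀ ε : ℝ, 0 < ε →
      Tendsto (fun n : ℕ => Measure.pi (fun _ : Fin n => (obsLaw P).toMeasure)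
        {s | ε ≤ dist (est n s) (Q P)}) atTop (𝓝 0)

/-- The probability of an event. -/
def pr {S : O ⊕ M → Type} (P : PMF (Config S)) (A : Set (Config S)) : ℝ :=
  (P.toOuterMeasure A).toReal

/-- The conditional probability of `A` given `B`. -/
def condPr {S : O ⊕ M → Type} (P : PMF (Config S)) (A B : Set (Config S)) : ℝ :=
  pr P (A ∩ B) / pr P B

/-- The event that the substantive variables in `B` have the values prescribed by `v`. -/
def valEvent {S : O ⊕ M → Type} (B : Set (O ⊕ M)) (v : ∀ a, S a) : Set (Config S) :=
  {x | ∀ a ∈ B, valOf x a = v a}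

/-- The event that `R_i = 0` for all `i` in `J`. -/
def indZero {S : O ⊕ M → Type} (J : Set M) : Set (Config S) :=
  {x | ∀ i ∈ J, indOf x i = 0}

/-- The joint distribution `P(V)` of the substantive variables. -/
def jointV {S : O ⊕ M → Type} (P : PMF (Config S)) : (∀ a, S a) → ℝ :=
  fun v => pr P (valEvent Set.univ v)

end Missing

end

/-! Sufficiency. The nodes reached from `R_i` by bidirected edges form its district, and `P` splits
as `F * H`: `F` collects the district and the latents with a child in it, `H` all the rest, and no
latent is shared. If `R_i` has a Markov blanket in `V`, the district contains no other indicator;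
apart from `R_i`, the district and its parents lie in `core`, the set of variables joined to `R_i`
by collider paths, which every blanket in `V` contains. Indicators have no children, so `H` ignores
`R_i`. Hence `P(R_i = 0 | E)` is one number `ρ i` for all events `E` of positive probability that
fix the core at `v` and do not concern `R_i` (`exists_condPr_indZero`). Adding the indicators one by
one gives `P(R = 0, v) = (∏ ρ i) * P(v)`. If the blanket omits `X`, fixing it together with its
indicators at `0` is again such an `E`, now visible in the data. By positivity the formula is
continuous at the observed law, so plugging in relative frequencies is consistent.

Necessity. Along a collider path from `X` to `R_X` every edge is bidirected, except that the first
may be directed forward. Take the density `1 + δ * interaction` with respect to the uniform law,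
where `interaction` vanishes if `R_X = 0` and is otherwise the product of the `±1` contrasts of the
nodes before `R_X`. Exchanging two values of `X` when it is hidden leaves the record unchanged and
turns `δ` into `-δ`, so both signs have the same observed law but different `P(V)`. The graph
generates these laws: latent fair bits on the bidirected edges couple neighbouring nodes, and
summing them out leaves only the product over the whole path (`sum_chain`). -/

namespace Missing

variable {O M U : Type*}

/-! ### Paths and their manipulation -/

/-- The kind of an edge when it is traversed in the opposite direction. -/
def EdgeKind.flip : EdgeKind → EdgeKind
  | .fwd => .bwd
  | .bwd => .fwd
  | .bi => .bi

@[simp] lemma EdgeKind.flip_headLeft (k : EdgeKind) : k.flip.headLeft ↔ k.headRight := by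
  cases k <;> simp [EdgeKind.flip, EdgeKind.headLeft, EdgeKind.headRight]

@[simp] lemma EdgeKind.flip_headRight (k : EdgeKind) : k.flip.headRight ↔ k.headLeft := by
  cases k <;> simp [EdgeKind.flip, EdgeKind.headLeft, EdgeKind.headRight]

namespace MGraph

variable {G : MGraph O M U}

lemma bidir.symm {a b : Node O M} (h : G.bidir a b) : G.bidir b a :=
  ⟨h.1.symm, h.2.imp fun _ hu => ⟨hu.2, hu.1⟩⟩

lemma isEdge_flip {k : EdgeKind} {a b : Node O M} (h : G.IsEdge k a b) :
    G.IsEdge k.flip b a := by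
  cases k
  · exact h
  · exact h
  · exact bidir.symm h

lemma IsEdge.ne {k : EdgeKind} {a b : Node O M} (h : G.IsEdge k a b) : a ≠ b := by
  rintro rfl
  cases k
  · exact G.acyclic a (.single h)
  · exact G.acyclic a (.single h)
  · exact h.1 rfl

/-- Without edges between indicators, indicators have no children. -/
lemma NoIndEdges.not_dir (hR : G.NoIndEdges) (i : M) (a : Node O M) : ¬ G.dir (ind i) a := by
  rcases a with a | j
  · exact G.ind_no_child i a
  · exact fun h => hR i j ⟨.fwd, h⟩

/-- Used to see that a collider at an indicator blocks a path given any set of substantive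
variables. -/
lemma NoIndEdges.eq_of_isDescendant (hR : G.NoIndEdges) {i : M} {d : Node O M}
    (h : G.IsDescendant (ind i) d) : d = ind i := by
  rcases Relation.ReflTransGen.cases_head h with h | ⟨c, hc, -⟩
  · exact h.symm
  · exact (hR.not_dir i c hc).elim

lemma NoIndEdges.headRight (hR : G.NoIndEdges) {k : EdgeKind} {a : Node O M} {i : M}
    (h : G.IsEdge k a (ind i)) : k.headRight := by
  cases k
  · trivial
  · exact hR.not_dir i a h
  · trivial

lemma NoIndEdges.headLeft (hR : G.NoIndEdges) {k : EdgeKind} {a : Node O M} {i : M}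
    (h : G.IsEdge k (ind i) a) : k.headLeft := by
  cases k
  · exact hR.not_dir i a h
  · trivial
  · trivial

namespace Trail

variable {a b c : Node O M}

/-- The initial segment of a path. -/
def take (p : G.Trail a b) (m : ℕ) (hm : m ≤ p.len) : G.Trail a (p.node m) where
  len := m
  node := p.node
  kind := p.kind
  start := p.start
  finish := rfl
  inj i hi j hj h := p.inj i (hi.trans hm) j (hj.trans hm) h
  edge i hi := p.edge i (hi.trans_le hm)

/-- The path traversed in the opposite direction. -/
def reverse (p : G.Trail a b) : G.Trail b a where
  len := p.len
  node j := p.node (p.len - j)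
  kind j := (p.kind (p.len - 1 - j)).flip
  start := by simpa using p.finish
  finish := by simpa using p.start
  inj i hi j hj h := by
    have := p.inj _ (Nat.sub_le _ _) _ (Nat.sub_le _ _) h
    omega
  edge i hi := by
    have h := isEdge_flip (p.edge (p.len - 1 - i) (by omega))
    rw [show p.len - 1 - i + 1 = p.len - i by omega] at h
    rwa [show p.len - (i + 1) = p.len - 1 - i by omega]

/-- The path of a single edge. -/
def single (k : EdgeKind) (h : G.IsEdge k a b) : G.Trail a b where
  len := 1
  node j := if j = 0 then a else b
  kind _ := k
  start := rfl
  finish := rfl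
  inj i hi j hj hij := by
    have := h.ne
    interval_cases i <;> interval_cases j <;> simp_all
  edge i hi := by
    obtain rfl : i = 0 := by omega
    simpa using h

/-- The path extended by an edge to a new node. -/
def snoc (p : G.Trail a b) (k : EdgeKind) (h : G.IsEdge k b c)
    (hc : ∀ j ≤ p.len, p.node j ≠ c) : G.Trail a c where
  len := p.len + 1
  node j := if j ≤ p.len then p.node j else c
  kind j := if j < p.len then p.kind j else k
  start := by simpa using p.start
  finish := by simp
  inj i hi j hj hij := by
    split_ifs at hij with h1 h2 h2
    · exact p.inj i h1 j h2 hij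
    · exact (hc i h1 hij).elim
    · exact (hc j h2 hij.symm).elim
    · omega
  edge i hi := by
    rcases Nat.lt_succ_iff_lt_or_eq.mp hi with h1 | rfl
    · simpa [h1, h1.le, Nat.succ_le_of_lt h1] using p.edge i h1
    · simpa [p.finish] using h

/-- All intermediate nodes are colliders and substantive variables. -/
def ViaColliders (p : G.Trail a b) : Prop :=
  ∀ j, 0 < j → j < p.len → p.IsCollider j ∧ ∃ c, p.node j = var c

lemma ViaColliders.take {p : G.Trail a b} (h : p.ViaColliders) (m : ℕ) (hm : m ≤ p.len) :
    (p.take m hm).ViaColliders :=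
  fun j h0 hj => h j h0 (hj.trans_le hm)

lemma ViaColliders.reverse {p : G.Trail a b} (h : p.ViaColliders) : p.reverse.ViaColliders := by
  intro j h0 hj
  change j < p.len at hj
  obtain ⟨⟨h1, h2⟩, hv⟩ := h (p.len - j) (by omega) (by omega)
  refine ⟨⟨?_, ?_⟩, hv⟩
  · change EdgeKind.headRight (EdgeKind.flip (p.kind (p.len - 1 - (j - 1))))
    rw [EdgeKind.flip_headRight, show p.len - 1 - (j - 1) = p.len - j by omega]
    exact h2
  · change EdgeKind.headLeft (EdgeKind.flip (p.kind (p.len - 1 - j)))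
    rw [EdgeKind.flip_headLeft, show p.len - 1 - j = p.len - j - 1 by omega]
    exact h1

lemma len_pos (p : G.Trail a b) (h : a ≠ b) : 0 < p.len := by
  rcases Nat.eq_zero_or_pos p.len with h0 | h0
  · exact (h (p.start.symm.trans ((congrArg p.node h0.symm).trans p.finish))).elim
  · exact h0

/-- All edges are bidirected, and all nodes after the first are substantive variables. -/
def Bidirected (p : G.Trail a b) : Prop :=
  (∀ j < p.len, p.kind j = .bi) ∧ ∀ j, 0 < j → j ≤ p.len → ∃ c, p.node j = var c

lemma Bidirected.viaColliders {p : G.Trail a b} (h : p.Bidirected) : p.ViaColliders := by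
  intro j h0 hj
  refine ⟨?_, h.2 j h0 hj.le⟩
  rw [IsCollider, h.1 j hj, h.1 (j - 1) (by omega)]
  exact ⟨trivial, trivial⟩

lemma Bidirected.take {p : G.Trail a b} (h : p.Bidirected) (m : ℕ) (hm : m ≤ p.len) :
    (p.take m hm).Bidirected :=
  ⟨fun j hj => h.1 j (hj.trans_le hm), fun j h0 hj => h.2 j h0 (hj.trans hm)⟩

/-- A bidirected path followed by an edge that has an arrowhead at the last node of the path
yields a path through colliders. -/
lemma Bidirected.exists_viaColliders {p : G.Trail a b} (h : p.Bidirected) {k : EdgeKind}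
    (hk : G.IsEdge k b c) (hl : k.headLeft) : ∃ q : G.Trail a c, q.ViaColliders := by
  by_cases hc : ∀ j ≤ p.len, p.node j ≠ c
  · refine ⟨p.snoc k hk hc, fun j h0 hj => ?_⟩
    change j < p.len + 1 at hj
    have hj' : j ≤ p.len := by omega
    refine ⟨?_, ?_⟩
    · have h1 : (p.snoc k hk hc).kind (j - 1) = .bi := by
        simp only [snoc, if_pos (show j - 1 < p.len by omega)]
        exact h.1 _ (by omega)
      refine ⟨by rw [h1]; trivial, ?_⟩
      simp only [snoc]
      split_ifs with h2
      · rw [h.1 j h2]; trivial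
      · exact hl
    · simp only [snoc, if_pos hj']
      exact h.2 j h0 hj'
  -- The new node is already on the path; the initial segment up to it is bidirected and serves as
  -- the path.
  · push Not at hc
    obtain ⟨j, hj, rfl⟩ := hc
    exact ⟨p.take j hj, (h.take j hj).viaColliders⟩

/-- A bidirected path can be extended by a bidirected edge to a substantive variable, up to
removing a loop. -/
lemma Bidirected.exists_bidirected {p : G.Trail a b} (h : p.Bidirected) {v : O ⊕ M}
    (hk : G.bidir b (var v)) : ∃ q : G.Trail a (var v), q.Bidirected := by
  by_cases hc : ∀ j ≤ p.len, p.node j ≠ var v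
  · refine ⟨p.snoc .bi hk hc, fun j _ => ?_, fun j h0 _ => ?_⟩
    · simp only [snoc]
      split_ifs with h2
      · exact h.1 j h2
      · rfl
    · simp only [snoc]
      split_ifs with h2
      · exact h.2 j h0 h2
      · exact ⟨v, rfl⟩
  · push Not at hc
    obtain ⟨j, hj, hjv⟩ := hc
    rw [← hjv]
    exact ⟨p.take j hj, h.take j hj⟩

end Trail

/-! ### Markov blankets and collider paths -/

/-- A Markov blanket of `R_i` contains every node that is connected to `R_i` by a path through
colliders. -/
lemma IsIndBlanket.mem_of_viaColliders {i : M} {B : Set (O ⊕ M)} (hB : G.IsIndBlanket i B)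
    {b : Node O M} (hb : b ≠ ind i) (p : G.Trail (ind i) b) (hp : p.ViaColliders) :
    b ∈ var '' B := by
  classical
  by_contra hbB
  -- Stop at the first node outside `B`. All intermediate nodes before it are colliders in `B`, so
  -- nothing blocks the segment.
  have hex : ∃ m, 0 < m ∧ m ≤ p.len ∧ p.node m ∉ (var '' B : Set (Node O M)) :=
    ⟨p.len, p.len_pos hb.symm, le_rfl, by rwa [p.finish]⟩
  obtain ⟨h0, hm, hmB⟩ := Nat.find_spec hex
  have hne : p.node (Nat.find hex) ≠ ind i := fun h =>
    h0.ne' (p.inj _ hm 0 (Nat.zero_le _) (h.trans p.start.symm))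
  obtain ⟨t, ht0, ht, h⟩ := hB.2 _ hne hmB (p.take _ hm)
  change t < Nat.find hex at ht
  have htB : p.node t ∈ (var '' B : Set (Node O M)) := by
    by_contra hn
    exact Nat.find_min hex ht ⟨ht0, ht.le.trans hm, hn⟩
  rcases h with ⟨-, h⟩ | ⟨h, -⟩
  · exact h _ htB Relation.ReflTransGen.refl
  · exact h (hp t ht0 (ht.trans_le hm)).1

/-- The substantive variables that are connected to `R_i` by a path through colliders. -/
def core (G : MGraph O M U) (i : M) : Set (O ⊕ M) :=
  {a | ∃ p : G.Trail (ind i) (var a), p.ViaColliders}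

lemma IsIndBlanket.core_subset {i : M} {B : Set (O ⊕ M)} (hB : G.IsIndBlanket i B) :
    G.core i ⊆ B := by
  rintro a ⟨p, hp⟩
  obtain ⟨c, hc, h⟩ := hB.mem_of_viaColliders (by simp) p hp
  rwa [← Sum.inl_injective h]

/-- If `R_i` has a Markov blanket among the substantive variables at all, then the variables
that are connected to it by paths through colliders form one. -/
lemma IsIndBlanket.core (hR : G.NoIndEdges) {i : M} {B : Set (O ⊕ M)}
    (hB : G.IsIndBlanket i B) : G.IsIndBlanket i (G.core i) := by
  refine ⟨by simp, fun b hb hbC p => ?_⟩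
  by_contra! hcon
  -- An unblocked path runs through substantive colliders only. If the nodes before `t` do, a
  -- substantive node `t` lies in the core and must be a collider to stay open; an indicator would
  -- be a collider with no descendant but itself, hence blocked.
  have key : ∀ t, 0 < t → t < p.len → p.IsCollider t ∧ ∃ c, p.node t = var c := by
    intro t
    induction t using Nat.strong_induction_on with
    | _ t ih =>
      intro h0 ht
      have hcol := hcon t h0 ht
      have hpre : (p.take t ht.le).ViaColliders := fun j hj0 hj =>
        ih j hj hj0 (hj.trans ht)
      have e1 := p.edge (t - 1) (by omega)
      have e2 := p.edge t ht
      rw [Nat.sub_add_cancel h0] at e1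
      rcases hn : p.node t with c | j
      · refine ⟨?_, c, rfl⟩
        by_contra hnc
        refine hcol.2 hnc ?_
        rw [hn]
        refine ⟨c, ?_, rfl⟩
        have := (⟨p.take t ht.le, hpre⟩ :
          ∃ q : G.Trail (ind i) (p.node t), q.ViaColliders)
        rwa [hn] at this
      · rw [hn] at e1 e2
        obtain ⟨d, ⟨c, -, rfl⟩, hd⟩ := hcol.1 ⟨hR.headRight e1, hR.headLeft e2⟩
        rw [hn] at hd
        exact absurd (hR.eq_of_isDescendant hd) (by simp)
  obtain ⟨c, -, rfl⟩ := hB.mem_of_viaColliders hb p key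
  exact hbC ⟨c, ⟨p, key⟩, rfl⟩

lemma notMem_core {i : M} (h : ¬ G.ColliderConnected i) : Sum.inr i ∉ G.core i :=
  fun ⟨p, hp⟩ => h ⟨p.reverse, hp.reverse⟩

/-! ### The district of an indicator -/

/-- The nodes that are connected to `R_i` by bidirected edges. -/
def district (G : MGraph O M U) (i : M) : Set (Node O M) :=
  {a | Relation.ReflTransGen G.bidir (ind i) a}

/-- A bidirected chain that reached a second indicator would be a collider path to it, and the
blanket, consisting of substantive variables, would have to contain that indicator. -/
lemma exists_bidirected_of_mem_district (hR : G.NoIndEdges) {i : M} {B : Set (O ⊕ M)}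
    (hB : G.IsIndBlanket i B) {a : Node O M} (ha : a ∈ G.district i) :
    a = ind i ∨ ∃ v, a = var v ∧ ∃ p : G.Trail (ind i) (var v), p.Bidirected := by
  induction ha with
  | refl => exact Or.inl rfl
  | @tail b c _ hbc ih =>
    rcases c with v | j
    · right
      refine ⟨v, rfl, ?_⟩
      rcases ih with rfl | ⟨w, rfl, p, hp⟩
      · exact ⟨.single .bi hbc, fun _ _ => rfl, fun j h0 _ => ⟨v, if_neg h0.ne'⟩⟩
      · exact hp.exists_bidirected hbc
    · left
      by_contra hne
      rcases ih with rfl | ⟨w, rfl, p, hp⟩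
      · exact hR i j ⟨.bi, hbc⟩
      · obtain ⟨q, hq⟩ := hp.exists_viaColliders (k := .bi) hbc trivial
        obtain ⟨c, -, h⟩ := hB.mem_of_viaColliders hne q hq
        exact absurd h (by simp)

lemma mem_district (hR : G.NoIndEdges) {i : M} {B : Set (O ⊕ M)}
    (hB : G.IsIndBlanket i B) {a : Node O M} (ha : a ∈ G.district i) :
    a = ind i ∨ ∃ v ∈ G.core i, a = var v := by
  rcases exists_bidirected_of_mem_district hR hB ha with h | ⟨v, rfl, p, hp⟩
  · exact Or.inl h
  · exact Or.inr ⟨v, ⟨p, hp.viaColliders⟩, rfl⟩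

/-- The arrow from the parent makes the end of the bidirected path a collider, so the extended path
still runs through colliders. -/
lemma mem_core_of_dir (hR : G.NoIndEdges) {i : M} {B : Set (O ⊕ M)}
    (hB : G.IsIndBlanket i B) {a b : Node O M} (ha : a ∈ G.district i) (hb : G.dir b a) :
    ∃ v ∈ G.core i, b = var v := by
  rcases b with v | j
  · refine ⟨v, ?_, rfl⟩
    rcases exists_bidirected_of_mem_district hR hB ha with rfl | ⟨w, rfl, p, hp⟩
    · refine ⟨.single .bwd hb, fun j h0 hj => ?_⟩
      change j < 1 at hj
      omega
    · exact hp.exists_viaColliders (k := .bwd) hb trivial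
  · exact (hR.not_dir j a hb).elim

/-- Two children of one latent variable lie in the same district. -/
lemma mem_district_of_lat {i : M} {u : U} {a b : Node O M} (ha : a ∈ G.district i)
    (hua : G.lat u a) (hub : G.lat u b) : b ∈ G.district i := by
  by_cases h : a = b
  · rwa [← h]
  · exact Relation.ReflTransGen.tail ha ⟨h, u, hua, hub⟩

end MGraph

/-! ### Factorization of the distribution -/

variable {G : MGraph O M U} {S : O ⊕ M → Type}

open Classical in
/-- The distribution splits into a factor of `R_i` and the variables that are connected to it by
paths through colliders, and a factor without `R_i`. -/
theorem MGraph.Generates.exists_factorization [Fintype O] [Fintype M] [Fintype U]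
    {P : PMF (Config S)} (hP : G.Generates S P) (hR : G.NoIndEdges)
    {i : M} {B : Set (O ⊕ M)} (hB : G.IsIndBlanket i B) :
    ∃ F H : Config S → ℝ≥0∞, (∀ x, P x = F x * H x) ∧
      (∀ x y, indOf x i = indOf y i → (∀ a ∈ G.core i, valOf x a = valOf y a) → F x = F y) ∧
      (∀ x y, (∀ a, a ≠ ind i → x a = y a) → H x = H y) := by
  obtain ⟨K, hK⟩ := hP
  let D : Node O M → Prop := fun a => a ∈ G.district i
  let L : U → Prop := fun u => ∃ a, D a ∧ G.lat u a
  -- Nodes inside and outside the district have no latent parent in common, so the integral over the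
  -- latents becomes a product.
  have hL : ∀ a, ¬ D a → ∀ u, G.lat u a → ¬ L u := fun a ha u hu ⟨b, hb, hub⟩ =>
    ha (G.mem_district_of_lat hb hub hu)
  let f : Config S → (∀ u : {u // L u}, K.T u) → ℝ≥0∞ := fun x s =>
    ∏ a : {a // D a}, K.cpd a (fun b => x b) (fun u => s ⟨u, a, a.2, u.2⟩) (x a)
  let h : Config S → (∀ u : {u // ¬ L u}, K.T u) → ℝ≥0∞ := fun x s =>
    ∏ a : {a // ¬ D a}, K.cpd a (fun b => x b) (fun u => s ⟨u, hL a a.2 u u.2⟩) (x a)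
  have hf : ∀ x, Measurable (f x) := fun x => Finset.measurable_prod _ fun a _ =>
    (K.measurable_cpd a _ _).comp (measurable_pi_lambda _ fun u => measurable_pi_apply _)
  have hh : ∀ x, Measurable (h x) := fun x => Finset.measurable_prod _ fun a _ =>
    (K.measurable_cpd a _ _).comp (measurable_pi_lambda _ fun u => measurable_pi_apply _)
  refine ⟨fun x => ∫⁻ s, f x s ∂(Measure.pi fun u : {u // L u} => K.μ u),
    fun x => ∫⁻ s, h x s ∂(Measure.pi fun u : {u // ¬ L u} => K.μ u), fun x => ?_, fun x y hi hc => ?_, fun x y hxy => ?_⟩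
  · rw [hK, ← lintegral_prod_mul (hf x).aemeasurable (hh x).aemeasurable,
      ← (measurePreserving_piEquivPiSubtypeProd K.μ L).lintegral_comp_emb
        (MeasurableEquiv.measurableEmbedding _)]
    refine lintegral_congr fun t => ?_
    rw [← Fintype.prod_subtype_mul_prod_subtype D]
    rfl
  · have hpar : ∀ a, D a → ∀ b, G.dir b a → x b = y b := fun a ha b hb => by
      obtain ⟨v, hv, rfl⟩ := G.mem_core_of_dir hR hB ha hb
      exact hc v hv
    have hself : ∀ a, D a → x a = y a := fun a ha => by
      rcases G.mem_district hR hB ha with rfl | ⟨v, hv, rfl⟩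
      · exact hi
      · exact hc v hv
    refine lintegral_congr fun s => Finset.prod_congr rfl fun a _ => ?_
    rw [hself a a.2, show (fun b : {b // G.dir b a} => x b) =
      fun b : {b // G.dir b a} => y b from funext fun b => hpar a a.2 b b.2]
  · have hself : ∀ a, ¬ D a → x a = y a := fun a ha =>
      hxy a fun h => ha (by subst h; exact Relation.ReflTransGen.refl)
    refine lintegral_congr fun s => Finset.prod_congr rfl fun a _ => ?_
    rw [hself a a.2, show (fun b : {b // G.dir b a} => x b) =
      fun b : {b // G.dir b a} => y b from
        funext fun b => hxy b fun h => hR.not_dir i a (h ▸ b.2)]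

/-! ### Conditional probabilities of the indicators and the formula for the joint -/

instance [∀ a, Fintype (S a)] : ∀ a : Node O M, Fintype (State S a)
  | Sum.inl a => inferInstanceAs (Fintype (S a))
  | Sum.inr _ => inferInstanceAs (Fintype (Fin 2))

/-- The joint value in which the substantive variables have the values `v` and every missingness
indicator has the value `r`. -/
def mkConfig (v : ∀ a, S a) (r : Fin 2) : Config S
  | Sum.inl a => v a
  | Sum.inr _ => r

lemma pr_eq_sum [Fintype (Config S)] (P : PMF (Config S)) (A : Set (Config S)) :
    pr P A = ∑ x, A.indicator (fun x => (P x).toReal) x := by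
  classical
  rw [pr, PMF.toOuterMeasure_apply_fintype, ENNReal.toReal_sum]
  · refine Finset.sum_congr rfl fun x _ => ?_
    by_cases h : x ∈ A <;> simp [h]
  · intro x _
    by_cases h : x ∈ A <;> simp [h, PMF.apply_ne_top]

lemma toOuterMeasure_ne_top (P : PMF (Config S)) (A : Set (Config S)) :
    P.toOuterMeasure A ≠ ∞ :=
  ((measure_mono (Set.subset_univ A)).trans_lt (by
    rw [(P.toOuterMeasure_apply_eq_one_iff _).2 (Set.subset_univ _)]
    exact ENNReal.one_lt_top)).ne

lemma pr_mono (P : PMF (Config S)) {A B : Set (Config S)} (h : A ⊆ B) : pr P A ≤ pr P B :=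
  ENNReal.toReal_mono (toOuterMeasure_ne_top P B) (P.toOuterMeasure.mono h)

lemma observe_eq_iff_of_indZero (v : ∀ a, S a) (x : Config S) :
    observe x = observe (mkConfig v 0) ↔
      x ∈ (indZero Set.univ ∩ valEvent Set.univ v : Set (Config S)) := by
  constructor
  · intro h
    have hi : ∀ i, indOf x i = 0 := fun i => congrFun (congrArg Record.ind h) i
    refine ⟨fun i _ => hi i, fun a _ => ?_⟩
    rcases a with o | i
    · exact congrFun (congrArg Record.obs h) o
    · have := congrFun (congrArg Record.proxy h) i
      simp only [observe, hi i, if_true] at this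
      exact Option.some_injective _ this
  · rintro ⟨hi, hv⟩
    have : x = mkConfig v 0 := by
      funext a
      rcases a with a | i
      · exact hv a trivial
      · exact hi i trivial
    rw [this]

lemma obsLaw_apply (P : PMF (Config S)) (x : Config S) :
    obsLaw P (observe x) = P.toOuterMeasure {y | observe y = observe x} := by
  rw [← PMF.toOuterMeasure_apply_singleton, obsLaw, PMF.toOuterMeasure_map_apply]
  rfl

/-- A complete record determines the configuration. This bound keeps all denominators of the formula
away from zero. -/
lemma ObsPositive.pr_indZero_pos {P : PMF (Config S)} (hP : ObsPositive P) (v : ∀ a, S a) :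
    0 < pr P (indZero Set.univ ∩ valEvent Set.univ v) := by
  refine ENNReal.toReal_pos ?_ (toOuterMeasure_ne_top _ _)
  have := hP (mkConfig v 0)
  rw [obsLaw_apply] at this
  convert this.ne' using 2
  ext x
  exact (observe_eq_iff_of_indZero v x).symm

section

variable [DecidableEq O] [DecidableEq M]

/-- The joint value with the value of `R_i` changed. -/
def flipInd (i : M) (x : Config S) : Config S :=
  Function.update x (ind i) (1 - indOf x i)

lemma flipInd_apply_of_ne {i : M} (x : Config S) {a : Node O M} (h : a ≠ ind i) :
    flipInd i x a = x a :=
  Function.update_of_ne h _ _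

lemma indOf_flipInd (i : M) (x : Config S) : indOf (flipInd i x) i = 1 - indOf x i :=
  Function.update_self (ind i) _ x

lemma flipInd_involutive (i : M) : Function.Involutive (flipInd (S := S) i) := by
  intro x
  funext a
  by_cases h : a = ind i
  · subst h
    exact (indOf_flipInd i _).trans (by rw [indOf_flipInd, sub_sub_cancel]; rfl)
  · rw [flipInd_apply_of_ne _ h, flipInd_apply_of_ne _ h]

/-- The conditional probability of `R_i = 0` is the same given all events that do not concern
`R_i` and determine the variables that are connected to it by paths through colliders. -/
theorem MGraph.Generates.exists_condPr_indZero [Fintype O] [Fintype M] [Fintype U]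
    [∀ a, Fintype (S a)] {P : PMF (Config S)} (hP : G.Generates S P) (hR : G.NoIndEdges)
    {i : M} {B : Set (O ⊕ M)} (hB : G.IsIndBlanket i B) (v : ∀ a, S a) :
    ∃ ρ : ℝ, ∀ E : Set (Config S), (∀ x, flipInd i x ∈ E ↔ x ∈ E) →
      E ⊆ valEvent (G.core i) v → pr P (indZero {i} ∩ E) = ρ * pr P E := by
  classical
  obtain ⟨F, H, hFH, hF, hH⟩ := hP.exists_factorization hR hB
  -- With the core fixed at `v`, the factor `F` depends on the value of `R_i` alone.
  set f : Fin 2 → ℝ := fun r => (F (mkConfig v r)).toReal with hf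
  have hfnn : ∀ r, 0 ≤ f r := fun r => ENNReal.toReal_nonneg
  refine ⟨f 0 / (f 0 + f 1), fun E hE hEv => ?_⟩
  have hval : ∀ x ∈ E, (P x).toReal = f (indOf x i) * (H x).toReal := fun x hx => by
    rw [hFH, ENNReal.toReal_mul, hF x (mkConfig v (indOf x i)) rfl (fun a ha => hEv hx a ha)]
  have hflip : ∀ x, H (flipInd i x) = H x := fun x =>
    hH _ _ fun a ha => flipInd_apply_of_ne x ha
  -- The mass of `H` on the half of `E` with `R_i = 0`; flipping `R_i` preserves `E` and `H`, so the
  -- other half has the same mass.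
  set g : ℝ := ∑ x, (if x ∈ E ∧ indOf x i = 0 then (H x).toReal else 0) with hg
  have hg' : ∑ x, (if x ∈ E ∧ indOf x i = 1 then (H x).toReal else 0) = g := by
    rw [hg, ← Equiv.sum_comp (flipInd_involutive (S := S) i).toPerm]
    refine Finset.sum_congr rfl fun x _ => ?_
    have h2 : (1 - indOf x i = 1) ↔ indOf x i = 0 := by
      generalize indOf x i = r
      revert r
      decide
    simp only [Function.Involutive.coe_toPerm, hE, indOf_flipInd, hflip, h2]
  have h0 : pr P (indZero {i} ∩ E) = f 0 * g := by
    rw [pr_eq_sum, hg, Finset.mul_sum]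
    refine Finset.sum_congr rfl fun x _ => ?_
    by_cases hx : x ∈ E <;> by_cases hi : indOf x i = 0 <;>
      simp [Set.indicator, indZero, hx, hi, hval]
  have h1 : pr P E = (f 0 + f 1) * g := by
    rw [add_mul]
    nth_rewrite 2 [← hg']
    rw [hg, pr_eq_sum, Finset.mul_sum, Finset.mul_sum, ← Finset.sum_add_distrib]
    refine Finset.sum_congr rfl fun x _ => ?_
    by_cases hx : x ∈ E
    · rcases (by generalize indOf x i = r; revert r; decide :
        indOf x i = 0 ∨ indOf x i = 1) with hi | hi <;>
        simp [Set.indicator, hx, hi, hval]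
    · simp [Set.indicator, hx]
  rw [h0, h1]
  -- If `f 0 + f 1 = 0`, both sides vanish, whatever the quotient by zero is.
  rcases (add_nonneg (hfnn 0) (hfnn 1)).eq_or_lt with hz | hpos
  · have : f 0 = 0 := le_antisymm (by linarith [hfnn 1]) (hfnn 0)
    rw [this]; simp
  · field_simp

/-- The joint distribution in terms of the observed-data distribution. -/
theorem MGraph.Generates.jointV_eq [Fintype O] [Fintype M] [Fintype U]
    [∀ a, Fintype (S a)] {P : PMF (Config S)} (hP : G.Generates S P) (hR : G.NoIndEdges)
    (hpos : ObsPositive P) {B : M → Set (O ⊕ M)}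
    (hB : ∀ i, G.IsIndBlanket i (B i) ∧ Sum.inr i ∉ B i) (v : ∀ a, S a) :
    jointV P v = pr P (indZero Set.univ ∩ valEvent Set.univ v) /
      ∏ i : M, condPr P (indZero {i}) (valEvent (B i) v ∩ indZero {j | Sum.inr j ∈ B i}) := by
  choose ρ hρ using fun i => hP.exists_condPr_indZero hR (hB i).1 v
  have hflip : ∀ i (A : Set (O ⊕ M)) (J : Set M), i ∉ J → ∀ x : Config S,
      flipInd i x ∈ valEvent A v ∩ indZero J ↔ x ∈ valEvent A v ∩ indZero J := by
    intro i A J hi x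
    refine and_congr (forall₂_congr fun a _ => ?_) (forall₂_congr fun j hj => ?_)
    · rw [valOf, flipInd_apply_of_ne x (by simp)]; rfl
    · rw [indOf, flipInd_apply_of_ne x (by rintro ⟨⟩; exact hi hj)]; rfl
  -- Each further indicator contributes its factor `ρ i`: the event already imposed fixes all of `V`
  -- and does not mention `R_i`.
  have hprod : ∀ s : Finset M, pr P (valEvent Set.univ v ∩ indZero (s : Set M)) =
      (∏ i ∈ s, ρ i) * jointV P v := by
    intro s
    induction s using Finset.induction_on with
    | empty => simp [indZero, jointV]
    | insert i s hi ih =>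
      rw [Finset.prod_insert hi, mul_assoc, ← ih, ← hρ i (valEvent Set.univ v ∩ indZero (s : Set M))
        (hflip i _ _ (by exact_mod_cast hi)) (fun x hx a _ => hx.1 a trivial)]
      congr 1
      ext x
      simp only [indZero, Finset.coe_insert, Set.mem_inter_iff, Set.mem_ofPred_eq,
        Set.mem_insert_iff, forall_eq_or_imp, Set.mem_singleton_iff, forall_eq]
      tauto
  have hmain := hpos.pr_indZero_pos v
  -- The event in the formula is another admissible one: it fixes the core because the blanket
  -- contains it, and it avoids `R_i` because the blanket omits the variable `i`.
  have hcond : ∀ i, condPr P (indZero {i})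
      (valEvent (B i) v ∩ indZero {j | Sum.inr j ∈ B i}) = ρ i := by
    intro i
    have hE : 0 < pr P (valEvent (B i) v ∩ indZero {j | Sum.inr j ∈ B i}) :=
      hmain.trans_le (pr_mono P fun x hx => ⟨fun a _ => hx.2 a trivial, fun j _ => hx.1 j trivial⟩)
    rw [condPr, hρ i _ (hflip i _ _ (hB i).2)
      (fun x hx a ha => hx.1 a ((hB i).1.core_subset ha)), mul_div_cancel_right₀ _ hE.ne']
  have hall := hprod Finset.univ
  rw [Finset.coe_univ, Set.inter_comm] at hall
  rw [Finset.prod_congr rfl fun i _ => hcond i, hall, mul_div_cancel_left₀]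
  rintro h
  rw [h, zero_mul] at hall
  exact hmain.ne' hall

end

/-! ### Consistency of plug-in estimators -/

/-- The relative frequency of the value `r` in a sample. -/
noncomputable def freq {α : Type*} {n : ℕ} (s : Fin n → α) (r : α) : ℝ :=
  (∑ i, Set.indicator {r} 1 (s i)) / n

/-- The weak law of large numbers for relative frequencies. -/
theorem tendsto_measure_freq {α : Type*} [MeasurableSpace α] [MeasurableSingletonClass α]
    (p : PMF α) (r : α) {ε : ℝ} (hε : 0 < ε) :
    Tendsto (fun n : ℕ => Measure.pi (fun _ : Fin n => p.toMeasure)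
      {s | ε ≤ |freq s r - (p r).toReal|}) atTop (𝓝 0) := by
  set φ : α → ℝ := Set.indicator {r} 1 with hφ
  have hφm : Measurable φ := measurable_one.indicator (measurableSet_singleton r)
  have hφb : ∀ a, φ a ∈ Set.Icc (0 : ℝ) 1 := fun a => by
    by_cases h : a ∈ ({r} : Set α) <;> simp [hφ, h]
  have hφL : MemLp φ 2 p.toMeasure :=
    memLp_of_bounded (Eventually.of_forall hφb) hφm.aestronglyMeasurable 2
  have hmean : ∫ a, φ a ∂p.toMeasure = (p r).toReal := by
    rw [hφ, integral_indicator_one (measurableSet_singleton r), Measure.real,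
      PMF.toMeasure_apply_singleton _ _ (measurableSet_singleton r)]
  have hvar : ProbabilityTheory.variance φ p.toMeasure ≤ 1 := by
    refine (ProbabilityTheory.variance_le_sq_of_bounded (Eventually.of_forall hφb)
      hφm.aemeasurable).trans ?_
    norm_num
  -- Chebyshev for the count: its variance is at most `n` and the deviation is `n * ε`.
  have hbound : ∀ n : ℕ, 0 < n → Measure.pi (fun _ : Fin n => p.toMeasure)
      {s | ε ≤ |freq s r - (p r).toReal|} ≤ ENNReal.ofReal (ε⁻¹ ^ 2 * (n : ℝ)⁻¹) := by
    intro n hn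
    have hn' : (0 : ℝ) < n := by exact_mod_cast hn
    set μ := Measure.pi (fun _ : Fin n => p.toMeasure) with hμ
    have hXi : ∀ i : Fin n, MemLp (fun s : Fin n → α => φ (s i)) 2 μ := fun i =>
      hφL.comp_measurePreserving (measurePreserving_eval _ i)
    have hX : MemLp (∑ i : Fin n, fun s : Fin n → α => φ (s i)) 2 μ :=
      memLp_finsetSum' _ fun i _ => hXi i
    have hE : ∫ s, (∑ i : Fin n, fun s : Fin n → α => φ (s i)) s ∂μ = n * (p r).toReal := by
      simp only [Finset.sum_apply]
      rw [integral_finsetSum _ fun i _ => (hXi i).integrable (by norm_num)]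
      have : ∀ i : Fin n, ∫ s, φ (s i) ∂μ = (p r).toReal := fun i => by
        rw [hμ, integral_comp_eval (μ := fun _ : Fin n => p.toMeasure) hφm.aestronglyMeasurable,
          hmean]
      simp [this]
    have hV : ProbabilityTheory.variance (∑ i : Fin n, fun s : Fin n → α => φ (s i)) μ ≤ n := by
      rw [hμ, ProbabilityTheory.variance_sum_pi (X := fun _ => φ) fun _ => hφL]
      simpa using mul_le_of_le_one_right hn'.le hvar
    have hcheb := ProbabilityTheory.meas_ge_le_variance_div_sq hX (mul_pos hn' hε)
    rw [hE] at hcheb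
    refine (measure_mono fun s hs => ?_).trans (hcheb.trans (ENNReal.ofReal_le_ofReal ?_))
    · have h1 : (∑ i : Fin n, fun s : Fin n → α => φ (s i)) s - n * (p r).toReal =
          n * (freq s r - (p r).toReal) := by
        simp only [Finset.sum_apply, freq]
        rw [mul_sub, mul_div_cancel₀ _ hn'.ne']
      change (n : ℝ) * ε ≤ |_ - _|
      rw [h1, abs_mul, abs_of_pos hn']
      exact mul_le_mul_of_nonneg_left hs hn'.le
    · rw [div_le_iff₀ (by positivity)]
      refine hV.trans (le_of_eq ?_)
      field_simp
  have hlim : Tendsto (fun n : ℕ => ENNReal.ofReal (ε⁻¹ ^ 2 * (n : ℝ)⁻¹)) atTop (𝓝 0) := by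
    have := ENNReal.tendsto_ofReal
      ((tendsto_inv_atTop_nhds_zero_nat (𝕜 := ℝ)).const_mul (ε⁻¹ ^ 2))
    simpa using this
  refine tendsto_of_tendsto_of_tendsto_of_le_of_le' tendsto_const_nhds hlim
    (Eventually.of_forall fun _ => zero_le) ?_
  filter_upwards [eventually_gt_atTop 0] with n hn using hbound n hn

instance [Finite O] [Finite M] [∀ a, Finite (S a)] : Finite (Record S) :=
  Finite.of_injective (fun r : Record S => (r.obs, r.proxy, r.ind)) fun r r' h => by
    simp only [Prod.mk.injEq] at h
    exact Record.ext h.1 h.2.1 h.2.2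

instance : MeasurableSingletonClass (Record S) := ⟨fun _ => trivial⟩

/-- A functional of the observed-data distribution is recoverable if it is continuous. -/
theorem MGraph.recoverable_of_continuousAt [Fintype O] [Fintype M] [Fintype U]
    [∀ a, Finite (S a)] {E : Type*} [PseudoMetricSpace E] {Q : PMF (Config S) → E}
    (Φ : (Record S → ℝ) → E)
    (hQ : ∀ P : PMF (Config S), G.Generates S P → ObsPositive P →
      Q P = Φ fun r => (obsLaw P r).toReal)
    (hΦ : ∀ P : PMF (Config S), G.Generates S P → ObsPositive P →
      ContinuousAt Φ fun r => (obsLaw P r).toReal) :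
    G.Recoverable S Q := by
  classical
  have : Fintype (Record S) := Fintype.ofFinite _
  refine ⟨fun n s => Φ (freq s), fun P hP hpos ε hε => ?_⟩
  obtain ⟨δ, hδ, hcont⟩ := Metric.continuousAt_iff.mp (hΦ P hP hpos) ε hε
  have hsum := tendsto_finsetSum (Finset.univ : Finset (Record S)) fun r _ =>
    tendsto_measure_freq (obsLaw P) r hδ
  rw [Finset.sum_const_zero] at hsum
  refine tendsto_of_tendsto_of_tendsto_of_le_of_le tendsto_const_nhds hsum
    (fun _ => zero_le) fun n => ?_
  -- An error of at least `ε` forces some record's frequency to be off by at least `δ`; the union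
  -- bound over the finitely many records applies.
  refine (measure_mono fun s hs => ?_).trans (measure_biUnion_finset_le _ _)
  by_contra hcon
  simp only [Set.mem_iUnion, not_exists] at hcon
  have hd : dist (freq s) (fun r => (obsLaw P r).toReal) < δ := by
    rw [dist_pi_lt_iff hδ]
    intro r
    have := hcon r (Finset.mem_univ r)
    rw [Real.dist_eq]
    exact not_le.mp this
  have h2 := hcont hd
  rw [← hQ P hP hpos] at h2
  exact absurd hs (not_le.mpr h2)

/-- By `hE` the event is a union of fibres of `observe`, so its probability is a function of the
observed law. -/
lemma pr_eq_sum_obsLaw [Fintype (Record S)] (P : PMF (Config S)) {E : Set (Config S)}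
    (hE : ∀ x y, observe x = observe y → y ∈ E → x ∈ E) :
    pr P E = ∑ r, (observe '' E).indicator (fun r => (obsLaw P r).toReal) r := by
  classical
  have h : P.toOuterMeasure E = (obsLaw P).toOuterMeasure (observe '' E) := by
    rw [obsLaw, PMF.toOuterMeasure_map_apply]
    congr 1
    exact Set.Subset.antisymm (Set.subset_preimage_image _ _)
      fun x ⟨y, hy, hxy⟩ => hE x y hxy.symm hy
  rw [pr, h, PMF.toOuterMeasure_apply_fintype, ENNReal.toReal_sum]
  · refine Finset.sum_congr rfl fun x _ => ?_
    by_cases h : x ∈ observe '' E <;> simp only [Set.indicator, h, if_true, if_false,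
      ENNReal.toReal_zero]
  · intro x _
    by_cases h : x ∈ observe '' E <;> simp only [Set.indicator, h, if_true, if_false]
    · exact PMF.apply_ne_top _ _
    · exact ENNReal.zero_ne_top

/-- If every indicator has a Markov blanket that does not contain its variable, then the joint
distribution is recoverable. -/
theorem MGraph.recoverable_jointV [Fintype O] [Fintype M] [Fintype U] [DecidableEq O]
    [DecidableEq M] [∀ a, Fintype (S a)] (hR : G.NoIndEdges) {B : M → Set (O ⊕ M)}
    (hB : ∀ i, G.IsIndBlanket i (B i) ∧ Sum.inr i ∉ B i) : G.Recoverable S jointV := by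
  classical
  have : Fintype (Record S) := Fintype.ofFinite _
  let E : M → (∀ a, S a) → Set (Config S) := fun i v =>
    valEvent (B i) v ∩ indZero {j | Sum.inr j ∈ B i}
  let W : Set (Config S) → (Record S → ℝ) → ℝ := fun A p => ∑ r, (observe '' A).indicator p r
  have hW : ∀ A, Continuous (W A) := fun A => continuous_finsetSum _ fun r _ => by
    by_cases h : r ∈ observe '' A
    · simpa only [Set.indicator, h, if_true] using continuous_apply r
    · simpa only [Set.indicator, h, if_false] using continuous_const
  have hind : ∀ x y : Config S, observe x = observe y → ∀ i, indOf x i = indOf y i :=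
    fun x y h i => congrFun (congrArg Record.ind h) i
  have hval : ∀ x y : Config S, observe x = observe y → ∀ i, indOf y i = 0 →
      valOf x (Sum.inr i) = valOf y (Sum.inr i) := fun x y h i hi => by
    have := congrFun (congrArg Record.proxy h) i
    simp only [observe, hind x y h i, hi, if_true] at this
    exact Option.some_injective _ this
  -- The record decides such an event because a partially observed value is prescribed only where
  -- its indicator is required to be `0`.
  have hsat : ∀ (A : Set (O ⊕ M)) (J : Set M) (v : ∀ a, S a), (∀ i, Sum.inr i ∈ A → i ∈ J) →
      ∀ x y, observe x = observe y → y ∈ indZero J ∩ valEvent A v →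
        x ∈ indZero J ∩ valEvent A v := by
    intro A J v hAJ x y h hy
    refine ⟨fun i hi => (hind x y h i).trans (hy.1 i hi), fun a ha => ?_⟩
    rcases a with o | i
    · exact (congrFun (congrArg Record.obs h) o).trans (hy.2 _ ha)
    · exact (hval x y h i (hy.1 i (hAJ i ha))).trans (hy.2 _ ha)
  have hfull : ∀ (P : PMF (Config S)) v, pr P (indZero Set.univ ∩ valEvent Set.univ v) =
      W (indZero Set.univ ∩ valEvent Set.univ v) fun r => (obsLaw P r).toReal := fun P v =>
    pr_eq_sum_obsLaw P (hsat _ _ v fun _ _ => trivial)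
  have hden : ∀ (P : PMF (Config S)) i v, pr P (E i v) =
      W (E i v) fun r => (obsLaw P r).toReal := fun P i v =>
    pr_eq_sum_obsLaw P (by
      have := hsat (B i) {j | Sum.inr j ∈ B i} v fun _ h => h
      rwa [Set.inter_comm] at this)
  have hnum : ∀ (P : PMF (Config S)) i v, pr P (indZero {i} ∩ E i v) =
      W (indZero {i} ∩ E i v) fun r => (obsLaw P r).toReal := fun P i v =>
    pr_eq_sum_obsLaw P (by
      have := hsat (B i) {j | Sum.inr j ∈ B i} v fun _ h => h
      rw [Set.inter_comm] at this
      exact fun x y h hy => ⟨fun j hj => (hind x y h j).trans (hy.1 j hj), this x y h hy.2⟩)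
  refine recoverable_of_continuousAt
    (fun p v => W (indZero Set.univ ∩ valEvent Set.univ v) p /
      ∏ i, (W (indZero {i} ∩ E i v) p / W (E i v) p)) (fun P hP hpos => ?_)
    fun P hP hpos => ?_
  · funext v
    rw [hP.jointV_eq hR hpos hB v, hfull]
    refine congrArg _ (Finset.prod_congr rfl fun i _ => ?_)
    rw [condPr, ← hnum, ← hden]
  · refine continuousAt_pi.mpr fun v => ?_
    have hpr := hpos.pr_indZero_pos v
    have h1 : ∀ i, W (E i v) (fun r => (obsLaw P r).toReal) ≠ 0 := fun i => by
      rw [← hden]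
      have hsub : indZero Set.univ ∩ valEvent Set.univ v ⊆ E i v := fun x hx =>
        ⟨fun a _ => hx.2 a trivial, fun j _ => hx.1 j trivial⟩
      exact (hpr.trans_le (pr_mono P hsub)).ne'
    have h2 : ∀ i, W (indZero {i} ∩ E i v) (fun r => (obsLaw P r).toReal) ≠ 0 := fun i => by
      rw [← hnum]
      have hsub : indZero Set.univ ∩ valEvent Set.univ v ⊆ indZero {i} ∩ E i v := fun x hx =>
        ⟨fun j _ => hx.1 j trivial, fun a _ => hx.2 a trivial, fun j _ => hx.1 j trivial⟩
      exact (hpr.trans_le (pr_mono P hsub)).ne'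
    refine (hW _).continuousAt.div (tendsto_finsetProd _ fun i _ =>
      (hW _).continuousAt.div (hW _).continuousAt (h1 i)) ?_
    exact Finset.prod_ne_zero_iff.mpr fun i _ => div_ne_zero (h2 i) (h1 i)

/-! ### Non-recoverability and tilted distributions -/

/-- Two distributions with the same observed-data distribution but different values of the target
quantity preclude recoverability. -/
theorem MGraph.not_recoverable [Fintype O] [Fintype M] [Fintype U] {E : Type*} [MetricSpace E]
    {Q : PMF (Config S) → E} {P₁ P₂ : PMF (Config S)} (h₁ : G.Generates S P₁)
    (h₂ : G.Generates S P₂) (hpos : ObsPositive P₁) (hobs : obsLaw P₁ = obsLaw P₂)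
    (hQ : Q P₁ ≠ Q P₂) : ¬ G.Recoverable S Q := by
  rintro ⟨est, hest⟩
  -- At half the distance, every estimate is bad for at least one of the two targets, so the two
  -- error probabilities add up to at least `1`.
  have hε : 0 < dist (Q P₁) (Q P₂) / 2 := half_pos (dist_pos.mpr hQ)
  have ht₁ := hest P₁ h₁ hpos _ hε
  have ht₂ := hest P₂ h₂ (fun x => hobs ▸ hpos x) _ hε
  rw [← hobs] at ht₂
  have hsum := ht₁.add ht₂
  rw [add_zero] at hsum
  refine absurd (ge_of_tendsto' hsum fun n => ?_) (not_le.mpr one_pos)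
  rw [← measure_univ (μ := Measure.pi fun _ : Fin n => (obsLaw P₁).toMeasure)]
  refine (measure_mono fun s _ => ?_).trans (measure_union_le _ _)
  by_contra hcon
  simp only [Set.mem_union, Set.mem_ofPred_eq, not_or, not_le] at hcon
  have := dist_triangle_left (Q P₁) (Q P₂) (est n s)
  linarith [hcon.1, hcon.2]

open Classical in
/-- The function that is `1` at `p`, `-1` at `q` and `0` elsewhere. -/
noncomputable def contrast {α : Type*} (p q s : α) : ℝ :=
  (if s = p then 1 else 0) - (if s = q then 1 else 0)

lemma abs_contrast_le {α : Type*} (p q s : α) : |contrast p q s| ≤ 1 := by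
  unfold contrast
  split_ifs <;> norm_num

lemma sum_contrast {α : Type*} [Fintype α] (p q : α) : ∑ s, contrast p q s = 0 := by
  classical
  simp only [contrast, Finset.sum_sub_distrib]
  rw [sub_eq_zero]
  convert (Fintype.sum_ite_eq p fun _ => (1 : ℝ)).trans
    (Fintype.sum_ite_eq q fun _ => (1 : ℝ)).symm using 3 <;> simp only [eq_comm]

open Classical in
lemma contrast_swap {α : Type*} (p q s : α) :
    contrast p q (Equiv.swap p q s) = - contrast p q s := by
  have h1 : Equiv.swap p q s = p ↔ s = q := by
    rw [Equiv.swap_apply_eq_iff, Equiv.swap_apply_left]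
  have h2 : Equiv.swap p q s = q ↔ s = p := by
    rw [Equiv.swap_apply_eq_iff, Equiv.swap_apply_right]
  simp only [contrast, h1, h2]
  ring

/-- A value of every node; `0` for the missingness indicators. -/
noncomputable def hi [∀ a, Nontrivial (S a)] : ∀ a : Node O M, State S a
  | Sum.inl a => (exists_pair_ne (S a)).choose
  | Sum.inr _ => (0 : Fin 2)

/-- Another value of every node; `1` for the missingness indicators. -/
noncomputable def lo [∀ a, Nontrivial (S a)] : ∀ a : Node O M, State S a
  | Sum.inl a => (exists_pair_ne (S a)).choose_spec.choose
  | Sum.inr _ => (1 : Fin 2)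

lemma hi_ne_lo [∀ a, Nontrivial (S a)] (a : Node O M) : hi (S := S) a ≠ lo a := by
  rcases a with a | i
  · exact (exists_pair_ne (S a)).choose_spec.choose_spec
  · exact (by decide : (0 : Fin 2) ≠ 1)

/-- The contrast of two values of the node `a`. -/
noncomputable def score [∀ a, Nontrivial (S a)] (a : Node O M) (s : State S a) : ℝ :=
  contrast (hi a) (lo a) s

section

variable [∀ a, Nontrivial (S a)]

lemma abs_score_le (a : Node O M) (s : State S a) : |score a s| ≤ 1 := abs_contrast_le _ _ _

lemma score_hi (a : Node O M) : score a (hi (S := S) a) = 1 := by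
  simp [score, contrast, hi_ne_lo]

lemma score_ind_zero (x : Config S) {i : M} (h : indOf x i = 0) :
    score (ind i) (x (ind i)) = 1 := by
  have : x (ind i) = hi (ind i) := h
  rw [this, score_hi]

lemma score_ind_one (x : Config S) {i : M} (h : indOf x i = 1) :
    score (ind i) (x (ind i)) = -1 := by
  have : x (ind i) = lo (ind i) := h
  rw [this, score, contrast, if_neg (hi_ne_lo (S := S) (ind i)).symm, if_pos rfl, zero_sub]

variable [∀ a, Fintype (S a)]

lemma tilt_sum (a : Node O M) {c : ℝ} (hc : |c| ≤ 1) :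
    ∑ s : State S a, ENNReal.ofReal ((1 + c * score a s) / Fintype.card (State S a)) = 1 := by
  have : Nonempty (State S a) := ⟨hi a⟩
  rw [← ENNReal.ofReal_sum_of_nonneg]
  · rw [← Finset.sum_div, Finset.sum_add_distrib, ← Finset.mul_sum,
      show ∑ s, score a s = 0 from sum_contrast _ _]
    simp
  · intro s _
    have : |c * score a s| ≤ 1 := by
      rw [abs_mul]
      exact mul_le_one₀ hc (abs_nonneg _) (abs_score_le a s)
    exact div_nonneg (by linarith [(abs_le.mp this).1]) (by positivity)

open Classical in
/-- The distribution of the node `a` with density `1 + c * score a` with respect to the uniform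
distribution. -/
noncomputable def tilt (a : Node O M) (c : ℝ) : PMF (State S a) :=
  if h : |c| ≤ 1 then PMF.ofFintype _ (tilt_sum a h) else PMF.pure (hi a)

lemma tilt_apply (a : Node O M) {c : ℝ} (h : |c| ≤ 1) (s : State S a) :
    tilt a c s = ENNReal.ofReal ((1 + c * score a s) / Fintype.card (State S a)) := by
  rw [tilt, dif_pos h, PMF.ofFintype_apply]

open Classical in
/-- Distributions in which all latent variables consist of independent fair bits, and every node
has a density `1 + c * score` given its parents, are generated by the graph. -/
theorem MGraph.generates_of_tilt [Fintype O] [Fintype M] [Fintype U] (m : ℕ)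
    (c : ∀ a : Node O M, (∀ b : {b // G.dir b a}, State S b) →
      ({u // G.lat u a} → Fin m → Bool) → ℝ) (hc : ∀ a y t, |c a y t| ≤ 1)
    (P : PMF (Config S))
    (hP : ∀ x, P x = ENNReal.ofReal ((∑ t : U → Fin m → Bool,
      ∏ a, (1 + c a (fun b => x b) (fun u => t u) * score a (x a))) /
        Fintype.card (U → Fin m → Bool) / ∏ a : Node O M, (Fintype.card (State S a) : ℝ))) :
    G.Generates S P := by
  refine ⟨{ T := fun _ => Fin m → Bool
            μ := fun _ => (PMF.uniformOfFintype (Fin m → Bool)).toMeasure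
            cpd := fun a y t => tilt a (c a y t)
            measurable_cpd := fun a y s => measurable_of_countable _ }, fun x => ?_⟩
  have hnn : ∀ (a : Node O M) t,
      0 ≤ (1 + c a (fun b => x b) t * score a (x a)) / (Fintype.card (State S a) : ℝ) := by
    intro a t
    have : |c a (fun b => x b) t * score a (x a)| ≤ 1 := by
      rw [abs_mul]
      exact mul_le_one₀ (hc _ _ _) (abs_nonneg _) (abs_score_le a _)
    exact div_nonneg (by linarith [(abs_le.mp this).1]) (by positivity)
  have hμ : ∀ t : U → Fin m → Bool,
      Measure.pi (fun _ : U => (PMF.uniformOfFintype (Fin m → Bool)).toMeasure) {t} =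
        ENNReal.ofReal (Fintype.card (U → Fin m → Bool) : ℝ)⁻¹ := by
    intro t
    rw [Measure.pi_singleton]
    simp only [PMF.toMeasure_apply_singleton _ _ (measurableSet_singleton _),
      PMF.uniformOfFintype_apply, Finset.prod_const, Finset.card_univ]
    rw [ENNReal.ofReal_inv_of_pos (by exact_mod_cast Fintype.card_pos), ENNReal.ofReal_natCast,
      Fintype.card_fun (α := U)]
    push_cast
    rw [ENNReal.inv_pow]
  rw [hP, lintegral_fintype]
  simp only [hμ]
  rw [Finset.sum_div, Finset.sum_div, ENNReal.ofReal_sum_of_nonneg]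
  · refine Finset.sum_congr rfl fun t _ => ?_
    rw [Finset.prod_congr rfl fun a _ => tilt_apply a (hc a _ _) (x a),
      ← ENNReal.ofReal_prod_of_nonneg fun a _ => hnn a _,
      ← ENNReal.ofReal_mul (Finset.prod_nonneg fun a _ => hnn a _), Finset.prod_div_distrib]
    congr 1
    ring
  · intro t _
    rw [div_right_comm, ← Finset.prod_div_distrib]
    exact div_nonneg (Finset.prod_nonneg fun a _ => hnn a _) (by positivity)

end

/-! ### Summing out latent bits along a chain -/

/-- Summing out the bits of a chain of nodes, each of which interacts with the bits on its two
sides. -/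
lemma sum_chain {T : Type*} [Fintype T] {k : ℕ} {b : ℕ → T → ℝ} (hb : ∀ j t, b j t * b j t = 1)
    {e : ℕ → T ≃ T} (he : ∀ j, j < k → ∀ t, b j (e j t) = - b j t)
    (he' : ∀ i j, i ≤ k → j ≤ k → i ≠ j → ∀ t, b i (e j t) = b i t)
    {s : ℕ → ℝ} {σ o : ℕ → T → ℝ} (hσ : ∀ t, σ 0 t = 1)
    (hstep : ∀ m < k, (∀ t, o m t = b m t ∧ σ (m + 1) t = b m t) ∨
      ∀ t, o m t = 0 ∧ σ (m + 1) t = ∏ j ∈ Finset.range (m + 1), s j) :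
    ∀ m ≤ k, ∀ w g : T → ℝ, (∀ j < m, ∀ t, w (e j t) = w t) → (∀ j < m, ∀ t, g (e j t) = g t) →
      ∑ t, (∏ j ∈ Finset.range m, (1 + σ j t * o j t * s j)) * ((1 + σ m t * w t * s m) * g t) =
        ∑ t, (1 + (∏ j ∈ Finset.range (m + 1), s j) * w t) * g t := by
  intro m
  -- Here `w` is what node `m` passes to the right and `g` stands for all factors further right.
  -- Both must vary: the step hands node `m + 1` over to `g`.
  induction m with
  | zero =>
    intro _ w g _ _
    simp [hσ, mul_comm]
  | succ m ih =>
    intro hm w g hw hg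
    have hm' : m < k := hm
    rcases hstep m hm' with h | h
    · have h1 := ih hm'.le (o m) (fun t => (1 + σ (m + 1) t * w t * s (m + 1)) * g t)
        (fun j hj t => by rw [(h _).1, (h _).1, he' m j hm'.le (by omega) (by omega)])
        (fun j hj t => by
          simp only [(h _).2, hw j (by omega), hg j (by omega),
            he' m j hm'.le (by omega) (show m ≠ j by omega)])
      simp only [Finset.prod_range_succ _ m, mul_assoc] at h1 ⊢
      rw [h1]
      set π := ∏ j ∈ Finset.range m, s j
      -- The terms linear in the bit `b m` cancel under its negation; in the quadratic term `b m * b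
      -- m = 1` joins the two contrasts.
      have hodd : ∑ t, b m t * ((π * s m + w t * s (m + 1)) * g t) = 0 := by
        have h2 := Equiv.sum_comp (e m) fun t => b m t * ((π * s m + w t * s (m + 1)) * g t)
        simp only [he m hm', hw m (Nat.lt_succ_self m), hg m (Nat.lt_succ_self m), neg_mul,
          Finset.sum_neg_distrib] at h2
        linarith
      rw [← sub_eq_zero, ← Finset.sum_sub_distrib, ← hodd]
      refine Finset.sum_congr rfl fun t _ => ?_
      rw [(h t).1, (h t).2, Finset.prod_range_succ, Finset.prod_range_succ]
      linear_combination (π * s m * w t * s (m + 1) * g t) * hb m t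
    · have h1 := ih hm'.le (o m) (fun t => (1 + σ (m + 1) t * w t * s (m + 1)) * g t)
        (fun j hj t => by rw [(h _).1, (h _).1])
        (fun j hj t => by simp only [(h _).2, hw j (by omega), hg j (by omega)])
      rw [Finset.sum_congr rfl fun t _ => show _ = _ by
        rw [Finset.prod_range_succ _ m, mul_assoc], h1]
      refine Finset.sum_congr rfl fun t _ => ?_
      rw [(h t).1, (h t).2, Finset.prod_range_succ _ (m + 1)]
      ring

/-- The sign of a bit. -/
def sign (c : Bool) : ℝ := if c then 1 else -1

lemma sign_mul_self (c : Bool) : sign c * sign c = 1 := by cases c <;> norm_num [sign]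

lemma sign_not (c : Bool) : sign (!c) = - sign c := by cases c <;> norm_num [sign]

lemma abs_sign (c : Bool) : |sign c| = 1 := by cases c <;> norm_num [sign]

open Classical in
/-- Negating one bit. -/
noncomputable def flipBit {ι : Type*} (l : ι) : (ι → Bool) ≃ (ι → Bool) :=
  Function.Involutive.toPerm (fun t => Function.update t l (!(t l))) fun t => by simp

open Classical in
lemma flipBit_self {ι : Type*} (l : ι) (t : ι → Bool) : flipBit l t l = !(t l) :=
  Function.update_self l _ t

open Classical in
lemma flipBit_of_ne {ι : Type*} {l l' : ι} (h : l' ≠ l) (t : ι → Bool) :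
    flipBit l t l' = t l' :=
  Function.update_of_ne h _ t

/-! ### Exchanging hidden values, and the interaction along a path -/

open Classical in
/-- The joint value with the value of the variable `i` exchanged if it is not observed. -/
noncomputable def swapHidden [∀ a, Nontrivial (S a)] (i : M) (x : Config S) : Config S :=
  if indOf x i = 1 then Function.update x (var (Sum.inr i))
    (Equiv.swap (hi (var (Sum.inr i))) (lo (var (Sum.inr i))) (x (var (Sum.inr i)))) else x

section

variable [∀ a, Nontrivial (S a)]

open Classical in
lemma swapHidden_of_ne {i : M} (x : Config S) {a : Node O M} (h : a ≠ var (Sum.inr i)) :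
    swapHidden i x a = x a := by
  unfold swapHidden
  split_ifs
  · exact Function.update_of_ne h _ _
  · rfl

lemma indOf_swapHidden (i j : M) (x : Config S) : indOf (swapHidden i x) j = indOf x j :=
  swapHidden_of_ne x (by simp)

open Classical in
lemma swapHidden_self {i : M} {x : Config S} (h : indOf x i = 1) :
    swapHidden i x (var (Sum.inr i)) = Equiv.swap (hi (var (Sum.inr i))) (lo (var (Sum.inr i)))
      (x (var (Sum.inr i))) := by
  rw [swapHidden, if_pos h, Function.update_self]

open Classical in
lemma swapHidden_involutive (i : M) : Function.Involutive (swapHidden (S := S) i) := by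
  intro x
  by_cases h : indOf x i = 1
  · funext a
    by_cases ha : a = var (Sum.inr i)
    · subst ha
      rw [swapHidden_self (by rwa [indOf_swapHidden]), swapHidden_self h, Equiv.swap_apply_self]
    · rw [swapHidden_of_ne _ ha, swapHidden_of_ne _ ha]
  · have : swapHidden i x = x := if_neg h
    rw [this, this]

/-- The value changes only when `R_i = 1`, and then the proxy is empty. -/
lemma observe_swapHidden (i : M) (x : Config S) : observe (swapHidden i x) = observe x := by
  refine Record.ext ?_ ?_ ?_
  · funext o
    exact swapHidden_of_ne x (by simp)
  · funext j
    simp only [observe, indOf_swapHidden]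
    split_ifs with h
    · refine congrArg some ?_
      by_cases hj : j = i
      · subst hj
        have : swapHidden j x = x := if_neg (by rw [h]; decide)
        rw [this]
      · exact swapHidden_of_ne x (by simpa using hj)
    · rfl
  · funext j
    exact indOf_swapHidden i j x

/-- The interaction of the nodes of a path to `R_i` in the cases in which `R_i = 1`. -/
noncomputable def interaction {i : M} {a : Node O M} (p : G.Trail a (ind i))
    (x : Config S) : ℝ :=
  (1 - score (ind i) (x (ind i))) / 2 *
    ∏ j ∈ Finset.range p.len, score (p.node j) (x (p.node j))

lemma abs_interaction_le {i : M} {a : Node O M} (p : G.Trail a (ind i)) (x : Config S) :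
    |interaction p x| ≤ 1 := by
  rw [interaction, abs_mul, Finset.abs_prod]
  refine mul_le_one₀ ?_ (Finset.prod_nonneg fun _ _ => abs_nonneg _)
    (Finset.prod_le_one (fun _ _ => abs_nonneg _) fun _ _ => abs_score_le _ _)
  have := abs_le.mp (abs_score_le (ind i) (x (ind i)))
  rw [abs_le]
  constructor <;> linarith [this.1, this.2]

-- If `R_i = 0`, the first factor vanishes. If `R_i = 1`, exactly one factor of the product changes
-- sign, since a path visits the variable `i` only once.
open Classical in
lemma interaction_swapHidden {i : M} (p : G.Trail (var (Sum.inr i)) (ind i)) (x : Config S) :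
    interaction p (swapHidden i x) = - interaction p x := by
  by_cases h : indOf x i = 1
  · have hlen := p.len_pos (by simp)
    have h1 : swapHidden i x (ind i) = x (ind i) := swapHidden_of_ne x (by simp)
    obtain ⟨k, hk⟩ : ∃ k, p.len = k + 1 := ⟨p.len - 1, by omega⟩
    have h0 : score (p.node 0) (swapHidden i x (p.node 0)) =
        - score (p.node 0) (x (p.node 0)) := by
      rw [p.start, swapHidden_self h]
      exact contrast_swap _ _ _
    rw [interaction, interaction, h1, hk, Finset.prod_range_succ', Finset.prod_range_succ', h0,
      Finset.prod_congr rfl fun j hj => ?_]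
    · ring
    · rw [swapHidden_of_ne]
      intro hj'
      have := p.inj (j + 1) (by have := Finset.mem_range.mp hj; omega) 0 (Nat.zero_le _)
        (hj'.trans p.start.symm)
      omega
  · have h0 : indOf x i = 0 := by
      revert h
      generalize indOf x i = r
      revert r
      decide
    rw [interaction, interaction, score_ind_zero x h0,
      score_ind_zero _ (by rwa [indOf_swapHidden])]
    simp

variable [∀ a, Fintype (S a)]

/-- Being odd under `swapHidden`, the interaction sums to zero. -/
lemma sum_tilted [Fintype O] [Fintype M] [DecidableEq O] [DecidableEq M] {i : M}
    (p : G.Trail (var (Sum.inr i)) (ind i)) {δ : ℝ} (hδ : |δ| ≤ 1) :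
    ∑ x : Config S, ENNReal.ofReal ((1 + δ * interaction p x) /
      ∏ a : Node O M, (Fintype.card (State S a) : ℝ)) = 1 := by
  have : ∀ a, Nonempty (State S a) := fun a => ⟨hi a⟩
  rw [← ENNReal.ofReal_sum_of_nonneg]
  · have hodd : ∑ x : Config S, interaction p x = 0 := by
      have h := Equiv.sum_comp (swapHidden_involutive (S := S) i).toPerm (interaction p)
      simp only [Function.Involutive.coe_toPerm, interaction_swapHidden,
        Finset.sum_neg_distrib] at h
      linarith
    rw [← Finset.sum_div, Finset.sum_add_distrib, ← Finset.mul_sum, hodd, mul_zero, add_zero,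
      Finset.sum_const, nsmul_one, Finset.card_univ, Fintype.card_pi, Nat.cast_prod, div_self,
      ENNReal.ofReal_one]
    exact Finset.prod_ne_zero_iff.mpr fun a _ => by exact_mod_cast Fintype.card_ne_zero
  · intro x _
    have : |δ * interaction p x| ≤ 1 := by
      rw [abs_mul]
      exact mul_le_one₀ hδ (abs_nonneg _) (abs_interaction_le p x)
    exact div_nonneg (by linarith [(abs_le.mp this).1]) (by positivity)

/-- The distribution of all variables in which the nodes of a path to `R_i` interact with
strength `δ` if `R_i = 1`. -/
noncomputable def tilted [Fintype O] [Fintype M] [DecidableEq O] [DecidableEq M] {i : M}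
    (p : G.Trail (var (Sum.inr i)) (ind i)) {δ : ℝ} (hδ : |δ| ≤ 1) : PMF (Config S) :=
  PMF.ofFintype _ (sum_tilted p hδ)

/-- If the graph generates all weak interactions along a path from `X` to `R_X`, then the joint
distribution is not recoverable. -/
theorem MGraph.not_recoverable_of_generates_tilted [Fintype O] [Fintype M] [Fintype U]
    [DecidableEq O] [DecidableEq M] {i : M} (p : G.Trail (var (Sum.inr i)) (ind i))
    (hpc : p.ViaColliders)
    (hG : ∀ (δ : ℝ) (hδ : |δ| ≤ 1), |δ| ≤ 1 / 2 → G.Generates S (tilted (S := S) p hδ)) :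
    ¬ G.Recoverable S jointV := by
  have : ∀ a, Nonempty (State S a) := fun a => ⟨hi a⟩
  have hp : |(1 / 2 : ℝ)| ≤ 1 := by norm_num [abs_of_pos]
  have hn : |(-(1 / 2) : ℝ)| ≤ 1 := by rwa [abs_neg]
  have hN : 0 < ∏ a : Node O M, (Fintype.card (State S a) : ℝ) :=
    Finset.prod_pos fun a _ => by exact_mod_cast Fintype.card_pos
  refine not_recoverable (hG _ hp (by norm_num [abs_of_pos]))
    (hG _ hn (by norm_num [abs_of_pos])) ?_ ?_ ?_
  · intro x
    rw [obsLaw, PMF.map_apply]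
    refine lt_of_lt_of_le ?_ (ENNReal.le_tsum x)
    rw [if_pos rfl]
    refine ENNReal.ofReal_pos.mpr (div_pos ?_ hN)
    linarith [(abs_le.mp (abs_interaction_le p x)).1]
  · have : tilted (S := S) p hp = (tilted p hn).map (swapHidden i) := by
      ext x
      rw [← PMF.toOuterMeasure_apply_singleton (PMF.map _ _), PMF.toOuterMeasure_map_apply,
        show swapHidden i ⁻¹' {x} = {swapHidden i x} from ?_,
        PMF.toOuterMeasure_apply_singleton]
      · simp only [tilted, PMF.ofFintype_apply, interaction_swapHidden, neg_mul_neg]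
      · ext y
        exact ⟨fun h => by
            rw [← show swapHidden i y = x from h]
            exact (swapHidden_involutive i y).symm,
          fun h => by rw [show y = swapHidden i x from h]; exact swapHidden_involutive i x⟩
    rw [this, obsLaw, PMF.map_comp]
    congr 1
    funext x
    exact observe_swapHidden i x
  · intro h
    -- At these values all contrasts are `1`, so the interaction is nonnegative, and it is `1` where
    -- `R_i = 1`; the larger `δ` therefore gives `v` strictly more mass.
    set v : ∀ a, S a := fun a => hi (var a)
    have hv := congrFun h v
    simp only [jointV, pr_eq_sum] at hv
    have happ : ∀ (δ : ℝ) (hδ : |δ| ≤ 1) (x : Config S), (tilted p hδ x).toReal =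
        (1 + δ * interaction p x) / ∏ a : Node O M, (Fintype.card (State S a) : ℝ) := by
      intro δ hδ x
      rw [tilted, PMF.ofFintype_apply, ENNReal.toReal_ofReal]
      have : |δ * interaction p x| ≤ 1 := by
        rw [abs_mul]
        exact mul_le_one₀ hδ (abs_nonneg _) (abs_interaction_le p x)
      exact div_nonneg (by linarith [(abs_le.mp this).1]) hN.le
    have hint : ∀ x ∈ valEvent Set.univ v, interaction p x =
        (1 - score (ind i) (x (ind i))) / 2 := by
      intro x hx
      rw [interaction, Finset.prod_eq_one, mul_one]
      intro j hj
      obtain ⟨c, hc⟩ : ∃ c, p.node j = var c := by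
        rcases Nat.eq_zero_or_pos j with rfl | h0
        · exact ⟨_, p.start⟩
        · exact (hpc j h0 (Finset.mem_range.mp hj)).2
      rw [hc, show x (var c) = hi (var c) from hx c trivial, score_hi]
    have hone : mkConfig v 1 ∈ valEvent Set.univ v := fun a _ => rfl
    have hle : ∀ x ∈ valEvent Set.univ v, 0 ≤ interaction p x := fun x hx => by
      rw [hint x hx]
      linarith [(abs_le.mp (abs_score_le (ind i) (x (ind i)))).2]
    refine (Finset.sum_lt_sum (fun x _ => ?_) ⟨mkConfig v 1, Finset.mem_univ _, ?_⟩).ne' hv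
    · by_cases hx : x ∈ valEvent Set.univ v
      · rw [Set.indicator_of_mem hx, Set.indicator_of_mem hx, happ, happ]
        exact div_le_div_of_nonneg_right (by linarith [hle x hx]) hN.le
      · rw [Set.indicator_of_notMem hx, Set.indicator_of_notMem hx]
    · rw [Set.indicator_of_mem hone, Set.indicator_of_mem hone, happ, happ, hint _ hone,
        score_ind_one _ rfl]
      exact div_lt_div_of_pos_right (by norm_num) hN

end

/-! ### Generating the interaction from the graph -/

section

variable [∀ a, Nontrivial (S a)] [∀ a, Fintype (S a)] [Fintype O] [Fintype M] [Fintype U]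
  [DecidableEq O] [DecidableEq M]

-- Reduces generation to an identity of finite sums: the product of the node densities, averaged
-- over the latent bits, must be `1 + δ * interaction p x`.
open Classical in
lemma MGraph.generates_tilted_of_sum {i : M} (p : G.Trail (var (Sum.inr i)) (ind i)) {δ : ℝ}
    (hδ : |δ| ≤ 1) (m : ℕ) (c : ∀ a : Node O M, (∀ b : {b // G.dir b a}, State S b) →
      ({u // G.lat u a} → Fin m → Bool) → ℝ) (hc : ∀ a y t, |c a y t| ≤ 1)
    (hsum : ∀ x : Config S, ∑ t : U → Fin m → Bool,
      ∏ a, (1 + c a (fun b => x b) (fun u => t u) * score a (x a)) =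
        ∑ _t : U → Fin m → Bool, (1 + δ * interaction p x)) :
    G.Generates S (tilted (S := S) p hδ) := by
  refine generates_of_tilt m c hc _ fun x => ?_
  rw [hsum, tilted, PMF.ofFintype_apply, Finset.sum_const, nsmul_eq_mul, Finset.card_univ,
    mul_div_cancel_left₀]
  exact_mod_cast Fintype.card_ne_zero

open Classical in
/-- The interaction along a single edge `X → R_X` is generated by the graph. -/
lemma MGraph.generates_tilted_of_dir {i : M} (p : G.Trail (var (Sum.inr i)) (ind i))
    (hlen : p.len = 1) (hdir : G.dir (var (Sum.inr i)) (ind i)) {δ : ℝ} (hδ : |δ| ≤ 1)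
    (hδ' : |δ| ≤ 1 / 2) : G.Generates S (tilted (S := S) p hδ) := by
  have hs : ∀ s, |δ / 2 * score (S := S) (var (Sum.inr i)) s| ≤ 1 / 4 := fun s => by
    rw [abs_mul, abs_div, abs_two]
    have := mul_le_mul hδ' (abs_score_le (S := S) (var (Sum.inr i)) s) (abs_nonneg _) (by norm_num)
    linarith
  have hpos : ∀ s, 0 < 1 + δ / 2 * score (S := S) (var (Sum.inr i)) s := fun s => by
    linarith [(abs_le.mp (hs s)).1]
  -- With `a = δ / 2 * score X`, averaging `1 + δ * interaction` over `R_X` gives the density `1 +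
  -- a` of `X`; dividing by it gives the tilt `-a / (1 + a)` of `R_X`. No latent bits are needed.
  let c : ∀ a : Node O M, (∀ b : {b // G.dir b a}, State S b) →
      ({u // G.lat u a} → Fin 0 → Bool) → ℝ := fun a y _ =>
    if a = var (Sum.inr i) then δ / 2 else if a = ind i then
      (if h : G.dir (var (Sum.inr i)) a then
        -(δ / 2 * score (var (Sum.inr i)) (y ⟨_, h⟩)) /
          (1 + δ / 2 * score (var (Sum.inr i)) (y ⟨_, h⟩)) else 0) else 0
  refine generates_tilted_of_sum p hδ 0 c (fun a y t => ?_) fun x => ?_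
  · simp only [c]
    split_ifs with h1 h2 h3
    · rw [abs_div, abs_two]
      linarith
    · have h := hs (y ⟨_, h3⟩)
      have h' := hpos (y ⟨_, h3⟩)
      rw [abs_div, abs_neg, abs_of_pos h', div_le_one h']
      linarith [(abs_le.mp h).1]
    · simp
    · simp
  · refine Finset.sum_congr rfl fun t _ => ?_
    rw [← Finset.prod_subset (Finset.subset_univ {var (Sum.inr i), ind i}),
      Finset.prod_pair (by simp)]
    · have h1 : c (var (Sum.inr i)) (fun b => x b) (fun u => t u) = δ / 2 := if_pos rfl
      have h2 : c (ind i) (fun b => x b) (fun u => t u) =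
          -(δ / 2 * score (var (Sum.inr i)) (x (var (Sum.inr i)))) /
            (1 + δ / 2 * score (var (Sum.inr i)) (x (var (Sum.inr i)))) := by
        simp only [c]
        rw [if_neg (by simp), if_pos trivial, dif_pos hdir]
      have h3 := (hpos (x (var (Sum.inr i)))).ne'
      rw [h1, h2, interaction, hlen, Finset.prod_range_one, p.start]
      have hid : ∀ a r : ℝ, 1 + a ≠ 0 → (1 + a) * (1 + -a / (1 + a) * r) = 1 + a - a * r :=
        fun a r ha => by
          rw [mul_add, mul_one, ← mul_assoc, mul_div_cancel₀ _ ha]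
          ring
      rw [hid _ _ h3]
      ring
    · intro a _ ha
      simp only [Finset.mem_insert, Finset.mem_singleton, not_or] at ha
      simp only [c, if_neg ha.1, if_neg ha.2, zero_mul, add_zero]

open Classical in
/-- The interaction along a path of bidirected edges, except that the first of several edges may
be directed, is generated by the graph. -/
lemma MGraph.generates_tilted_of_chain {i : M} (p : G.Trail (var (Sum.inr i)) (ind i)) {k : ℕ}
    (hlen : p.len = k + 1) (hk : p.kind k = .bi)
    (hkind : ∀ j < k, p.kind j = .bi ∨ j = 0 ∧ p.kind j = .fwd) {δ : ℝ} (hδ : |δ| ≤ 1) :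
    G.Generates S (tilted (S := S) p hδ) := by
  set n := p.node
  have hedge : ∀ j ≤ k, p.kind j = .bi → ∃ u, G.lat u (n j) ∧ G.lat u (n (j + 1)) := by
    intro j hj hb
    have := p.edge j (by omega)
    rw [hb] at this
    exact this.2
  obtain ⟨u₀, -⟩ := hedge k le_rfl hk
  -- `l j` is a latent behind the edge `j`, with an arbitrary value for a directed edge. Different
  -- edges may share a latent, so each latent carries `k + 1` bits and the edge `j` uses the bit
  -- number `j`.
  have hu : ∀ j, ∃ u, j ≤ k → p.kind j = .bi → G.lat u (n j) ∧ G.lat u (n (j + 1)) := by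
    intro j
    by_cases h : j ≤ k ∧ p.kind j = .bi
    · exact (hedge j h.1 h.2).imp fun u hu _ _ => hu
    · exact ⟨u₀, fun h1 h2 => (h ⟨h1, h2⟩).elim⟩
  choose l hl using hu
  have hinj : ∀ i ≤ k + 1, ∀ j ≤ k + 1, n i = n j → i = j := fun i hi j hj h =>
    p.inj i (by omega) j (by omega) h
  -- The value `k + 2` marks nodes off the path, which get tilt `0` and are uniform.
  let pos : Node O M → ℕ := fun a => if h : ∃ j ≤ k + 1, n j = a then h.choose else k + 2
  have hpos : ∀ j ≤ k + 1, pos (n j) = j := fun j hj => by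
    have h : ∃ j' ≤ k + 1, n j' = n j := ⟨j, hj, rfl⟩
    simp only [pos, dif_pos h]
    exact hinj _ h.choose_spec.1 _ hj h.choose_spec.2
  let bit : ∀ a : Node O M, ({u // G.lat u a} → Fin (k + 1) → Bool) → ℕ → ℝ := fun a t j =>
    if h : G.lat (l j) a then sign (t ⟨l j, h⟩ (Fin.ofNat (k + 1) j)) else 1
  have hbit : ∀ a t j, |bit a t j| ≤ 1 := fun a t j => by
    simp only [bit]
    split_ifs
    · exact (abs_sign _).le
    · simp
  -- The tilt of a path node is `sig * out`: `sig` is what it receives over its left edge (the bit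
  -- of that edge, or its parent's contrast), `out` what it shares over its right edge.
  let sig : ∀ a : Node O M, (∀ b : {b // G.dir b a}, State S b) →
      ({u // G.lat u a} → Fin (k + 1) → Bool) → ℕ → ℝ := fun a y t j =>
    if j = 0 then 1 else if p.kind (j - 1) = .fwd then
      (if h : G.dir (n (j - 1)) a then score (n (j - 1)) (y ⟨_, h⟩) else 0)
    else bit a t (j - 1)
  -- `R_i` copies the last bit, so `(1 - bit) / 2` makes the last node before it respond only if
  -- `R_i = 1`; the strength `δ` enters here. A node whose right edge is directed is uniform.
  let out : ∀ a : Node O M, ({u // G.lat u a} → Fin (k + 1) → Bool) → ℕ → ℝ := fun a t j =>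
    if j = k + 1 then 1 else if j = k then δ * ((1 - bit a t k) / 2) else
      if p.kind j = .fwd then 0 else bit a t j
  have hsig : ∀ a y t j, |sig a y t j| ≤ 1 := fun a y t j => by
    simp only [sig]
    split_ifs
    · simp
    · exact abs_score_le _ _
    · simp
    · exact hbit _ _ _
  have hout : ∀ a t j, |out a t j| ≤ 1 := fun a t j => by
    simp only [out]
    split_ifs
    · simp
    · rw [abs_mul]
      refine mul_le_one₀ hδ (abs_nonneg _) ?_
      have := abs_le.mp (hbit a t k)
      rw [abs_le]
      constructor <;> linarith [this.1, this.2]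
    · simp
    · exact hbit _ _ _
  refine generates_tilted_of_sum p hδ (k + 1)
    (fun a y t => if pos a ≤ k + 1 then sig a y t (pos a) * out a t (pos a) else 0)
    (fun a y t => ?_) fun x => ?_
  · split_ifs
    · rw [abs_mul]
      exact mul_le_one₀ (hsig _ _ _ _) (abs_nonneg _) (hout _ _ _)
    · simp
  let T := U → Fin (k + 1) → Bool
  let s : ℕ → ℝ := fun j => score (n j) (x (n j))
  let b : ℕ → T → ℝ := fun j t => sign (t (l j) (Fin.ofNat (k + 1) j))
  let σ : ℕ → T → ℝ := fun j t => sig (n j) (fun b => x b) (fun u => t u) j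
  let o : ℕ → T → ℝ := fun j t => out (n j) (fun u => t u) j
  let e : ℕ → T ≃ T := fun j => (Equiv.curry U (Fin (k + 1)) Bool).symm.trans
    ((flipBit (l j, Fin.ofNat (k + 1) j)).trans (Equiv.curry U (Fin (k + 1)) Bool))
  have he : ∀ j t, b j (e j t) = - b j t := fun j t => by
    have : e j t (l j) (Fin.ofNat (k + 1) j) = !(t (l j) (Fin.ofNat (k + 1) j)) :=
      flipBit_self (l j, Fin.ofNat (k + 1) j) (Function.uncurry t)
    simp only [b, this, sign_not]
  have he' : ∀ i j, i ≤ k → j ≤ k → i ≠ j → ∀ t, b i (e j t) = b i t := by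
    intro i j hi hj hij t
    have hne : (l i, Fin.ofNat (k + 1) i) ≠ (l j, Fin.ofNat (k + 1) j) := by
      intro h
      have h2 := congrArg Fin.val (congrArg Prod.snd h)
      simp only [Fin.ofNat, Nat.mod_eq_of_lt (show i < k + 1 by omega),
        Nat.mod_eq_of_lt (show j < k + 1 by omega)] at h2
      exact hij h2
    have : e j t (l i) (Fin.ofNat (k + 1) i) = t (l i) (Fin.ofNat (k + 1) i) :=
      flipBit_of_ne hne (Function.uncurry t)
    simp only [b, this]
  have hbl : ∀ j ≤ k, p.kind j = .bi → ∀ t : T, bit (n j) (fun u => t u) j = b j t :=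
    fun j hj h t => dif_pos (hl j hj h).1
  have hbr : ∀ j ≤ k, p.kind j = .bi → ∀ t : T, σ (j + 1) t = b j t := fun j hj h t => by
    simp only [σ, sig, bit, b]
    rw [if_neg (Nat.succ_ne_zero j), Nat.add_sub_cancel, h, if_neg (by simp),
      dif_pos (hl j hj h).2]
  have hσ : ∀ t, σ 0 t = 1 := fun t => if_pos rfl
  have hstep : ∀ m < k, (∀ t, o m t = b m t ∧ σ (m + 1) t = b m t) ∨
      ∀ t, o m t = 0 ∧ σ (m + 1) t = ∏ j ∈ Finset.range (m + 1), s j := by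
    intro m hm
    rcases hkind m hm with h | ⟨rfl, h⟩
    · refine Or.inl fun t => ⟨?_, hbr m hm.le h t⟩
      rw [← hbl m hm.le h]
      simp only [o, out]
      rw [if_neg (by omega), if_neg (by omega), h, if_neg (by simp)]
    · refine Or.inr fun t => ⟨?_, ?_⟩
      · simp only [o, out]
        rw [if_neg (by omega), if_neg (by omega), h, if_pos rfl]
      · have hd : G.dir (n 0) (n (0 + 1)) := by
          have := p.edge 0 (by omega)
          rwa [h] at this
        simp only [σ, sig]
        rw [if_neg (Nat.succ_ne_zero 0), Nat.add_sub_cancel, h, if_pos rfl, dif_pos hd,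
          Finset.prod_range_one]
  have hprod : ∀ t : T, ∏ a, (1 + (if pos a ≤ k + 1 then
      sig a (fun b => x b) (fun u => t u) (pos a) * out a (fun u => t u) (pos a) else 0) *
        score a (x a)) =
      ∏ j ∈ Finset.range (k + 2), (1 + σ j t * o j t * s j) := by
    intro t
    rw [← Finset.prod_subset (Finset.subset_univ ((Finset.range (k + 2)).image n)),
      Finset.prod_image]
    · refine Finset.prod_congr rfl fun j hj => ?_
      have hj' : j ≤ k + 1 := by have := Finset.mem_range.mp hj; omega
      rw [hpos j hj', if_pos hj']
    · intro j hj j' hj' h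
      rw [Finset.coe_range, Set.mem_Iio] at hj hj'
      exact hinj j (by omega) j' (by omega) h
    · intro a _ ha
      have : ¬ pos a ≤ k + 1 := by
        have hno : ¬ ∃ j ≤ k + 1, n j = a := fun ⟨j, hj, h⟩ =>
          ha (Finset.mem_image.mpr ⟨j, Finset.mem_range.mpr (by omega), h⟩)
        simp only [pos, dif_neg hno]
        omega
      rw [if_neg this, zero_mul, add_zero]
  have hok : ∀ t, o k t = δ * ((1 - b k t) / 2) := fun t => by
    rw [← hbl k le_rfl hk]
    simp only [o, out]
    rw [if_neg (by omega), if_pos trivial]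
  have ho1 : ∀ t, o (k + 1) t = 1 := fun t => if_pos rfl
  have hchain := sum_chain (fun j t => sign_mul_self _) (fun j _ => he j) he' hσ hstep k le_rfl
    (fun t => δ * ((1 - b k t) / 2)) (fun t => 1 + b k t * s (k + 1))
    (fun j hj t => by rw [he' k j le_rfl hj.le hj.ne'])
    (fun j hj t => by rw [he' k j le_rfl hj.le hj.ne'])
  have hint : interaction p x =
      (1 - s (k + 1)) / 2 * ∏ j ∈ Finset.range (k + 1), s j := by
    have hs : s (k + 1) = score (ind i) (x (ind i)) := by
      simp only [s]
      rw [← hlen, show n p.len = ind i from p.finish]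
    rw [interaction, hlen, hs]
  rw [Finset.sum_congr rfl fun t _ => hprod t, hint]
  rw [Finset.sum_congr rfl fun t _ => show _ = _ by
    rw [Finset.prod_range_succ _ (k + 1), Finset.prod_range_succ _ k, hok, ho1,
      hbr k le_rfl hk, mul_one, mul_assoc (∏ j ∈ Finset.range k, _)], hchain]
  -- After the chain is summed out, each term is `(1 + π * δ * (1 - b) / 2) * (1 + b * s (k + 1))`
  -- with `b` the last bit; it differs from the target by a multiple of `b`.
  have hodd : ∑ t, b k t = 0 := by
    have h := Equiv.sum_comp (e k) (b k)
    simp only [he, Finset.sum_neg_distrib] at h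
    linarith
  set π := ∏ j ∈ Finset.range (k + 1), s j
  rw [← sub_eq_zero, ← Finset.sum_sub_distrib,
    ← mul_zero (s (k + 1) - π * δ / 2 + π * δ / 2 * s (k + 1)), ← hodd, Finset.mul_sum]
  refine Finset.sum_congr rfl fun t _ => ?_
  linear_combination (-(π * δ / 2 * s (k + 1))) * sign_mul_self (t (l k) (Fin.ofNat (k + 1) k))

/-- The joint distribution is not recoverable if a partially observed variable is connected to
its missingness indicator by a path through colliders. -/
theorem MGraph.not_recoverable_of_colliderConnected (hR : G.NoIndEdges) {i : M}
    (h : G.ColliderConnected i) : ¬ G.Recoverable S jointV := by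
  obtain ⟨p, hp⟩ := h
  refine not_recoverable_of_generates_tilted p hp fun δ hδ hδ' => ?_
  obtain ⟨k, hk⟩ : ∃ k, p.len = k + 1 :=
    ⟨p.len - 1, by have := p.len_pos (by simp); omega⟩
  have hright : ∀ j ≤ k, (p.kind j).headRight := by
    intro j hj
    rcases hj.lt_or_eq with hj | rfl
    · exact (hp (j + 1) (Nat.succ_pos j) (by omega)).1.1
    · have := p.edge j (by omega)
      rw [← hk, p.finish] at this
      exact hR.headRight this
  -- Every edge has an arrowhead at its right end; each edge but the first also starts at a
  -- collider, hence is bidirected.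
  have hkind : ∀ j ≤ k, p.kind j = .bi ∨ j = 0 ∧ p.kind j = .fwd := by
    intro j hj
    have h1 := hright j hj
    rcases Nat.eq_zero_or_pos j with rfl | h0
    · generalize p.kind 0 = κ at h1 ⊢
      cases κ
      · exact Or.inr ⟨rfl, rfl⟩
      · exact h1.elim
      · exact Or.inl rfl
    · have h2 := (hp j h0 (by omega)).1.2
      generalize p.kind j = κ at h1 h2 ⊢
      cases κ
      · exact h2.elim
      · exact h1.elim
      · exact Or.inl rfl
  rcases hkind k le_rfl with h | ⟨rfl, h⟩
  · exact generates_tilted_of_chain p hk h (fun j hj => hkind j hj.le) hδ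
  · refine generates_tilted_of_dir p hk ?_ hδ hδ'
    have := p.edge 0 (by omega)
    rw [h, p.start, show 0 + 1 = p.len from hk.symm, p.finish] at this
    exact this

end

/-- A single edge is a path without intermediate nodes, so the first alternative in (C) is a case of
the second. -/
lemma MGraph.Neighbors.colliderConnected {i : M}
    (h : G.Neighbors (var (Sum.inr i)) (ind i)) : G.ColliderConnected i := by
  obtain ⟨k, hk⟩ := h
  refine ⟨.single k hk, fun j h0 hj => ?_⟩
  change j < 1 at hj
  omega

end Missing

theorem theorem2 {O M U : Type*} [Fintype O] [Fintype M] [Fintype U]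
    [DecidableEq O] [DecidableEq M]
    (S : O ⊕ M → Type) [∀ a, Fintype (S a)] [∀ a, Nontrivial (S a)]
    (G : Missing.MGraph O M U) (hR : G.NoIndEdges) :
    -- necessity
    (G.Recoverable S Missing.jointV →
      ¬ ∃ i : M, G.Neighbors (Missing.var (Sum.inr i)) (Missing.ind i) ∨
        G.ColliderConnected i) ∧
    -- sufficiency, if the indicators have Markov blankets among the substantive variables
    ((∀ i : M, ∃ B : Set (O ⊕ M), G.IsIndBlanket i B) →
      (¬ ∃ i : M, G.Neighbors (Missing.var (Sum.inr i)) (Missing.ind i) ∨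
        G.ColliderConnected i) →
      G.Recoverable S Missing.jointV) ∧
    -- when recoverable: such blankets can be chosen without the variable itself
    (G.Recoverable S Missing.jointV →
      ∀ i : M, (∃ B : Set (O ⊕ M), G.IsIndBlanket i B) →
        ∃ B : Set (O ⊕ M), G.IsIndBlanket i B ∧ Sum.inr i ∉ B) ∧
    -- and every such choice yields the joint distribution
    (G.Recoverable S Missing.jointV →
      ∀ B : M → Set (O ⊕ M), (∀ i, G.IsIndBlanket i (B i) ∧ Sum.inr i ∉ B i) →
        ∀ P : PMF (Missing.Config S), G.Generates S P → Missing.ObsPositive P →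
          ∀ v : (∀ a, S a),
            Missing.jointV P v =
              Missing.pr P (Missing.indZero Set.univ ∩ Missing.valEvent Set.univ v) /
                ∏ i : M, Missing.condPr P (Missing.indZero {i})
                  (Missing.valEvent (B i) v ∩ Missing.indZero {j | Sum.inr j ∈ B i})) := by
  have hnec : G.Recoverable S Missing.jointV → ∀ i : M, ¬ G.ColliderConnected i :=
    fun hrec i hi => Missing.MGraph.not_recoverable_of_colliderConnected hR hi hrec
  refine ⟨fun hrec ⟨i, hi⟩ => hnec hrec i (hi.elim (fun h => h.colliderConnected) id),
    fun hB hC => ?_, fun hrec i ⟨B, hB⟩ => ?_, fun _ B hB P hP hpos v => ?_⟩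
  · exact Missing.MGraph.recoverable_jointV (B := G.core) hR fun i =>
      ⟨(hB i).elim fun _ h => h.core hR,
        Missing.MGraph.notMem_core fun h => hC ⟨i, Or.inr h⟩⟩
  · exact ⟨G.core i, hB.core hR, Missing.MGraph.notMem_core (hnec hrec i)⟩
  · exact hP.jointV_eq hR hpos hB v
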